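/- There is an absolute constant $C>0$ such that the following holds for all integers $d\ge 1$, all real numbers $c_1,c_2>0$, and $L:=\log(2+c_1+c_2)$. Let $D$ be a probability distribution on $\mathbb{R}^d$ that is affinely equivalent to a distribution $D'$ on $\mathbb{R}^d$ (that is, $D'$ is the image of $D$ under some invertible affine map of $\mathbb{R}^d$) such that 1. $\Pr_{x\sim D'}[\|x\|>d\alpha]\le c_1/\alpha$ for all $\alpha>0$, and 2. $\Pr_{x\sim D'}[|\langle x,v\rangle+b'|\le\alpha]\le c_2\alpha$ for all $\alpha>0$, all unit vectors $v\in\mathbb{R}^d$ and all $b'\in\mathbb{R}$. Fix $b\in\mathbb{R}$ and identify a vector $h\in\mathbb{R}^d$ with the affine function $h(y)=\langle h,y\rangle+b$ and its hyperplane $\{y: h(y)=0\}$ (so $b=0$ gives hyperplanes through the origin, $b=-1$ the hyperplanes $\langle h,y\rangle=1$). Let $n\ge C\,L\,d\log^2(d+1)$, and let $h_1,\dots,h_n$ be drawn independently from $D$. Then for every arrangement $H=(h_1,\dots,h_n)$ there is a deterministic linear decision tree $T_H$ that uses only label queries ($\operatorname{sign}(h_i(x))\in\{-1,0,1\}$)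 and comparison queries ($\operatorname{sign}(h_i(x)-h_j(x))\in\{-1,0,1\}$) and that solves the point location problem for $H$: for every $x\in\mathbb{R}^d$ it outputs the cell of $H$ containing $x$, i.e. the vector $(\operatorname{sign}(h_i(x)))_{i\le n}$. The trees can be chosen so that the depth of $T_H$ (the maximum number of queries over all inputs $x$) is a measurable function of $H$ with $$\mathbb{E}_{H\sim D^n}[\operatorname{depth}(T_H)]\le C\,L\,d\log(d+1)\,\log(d\log n)\,\log^2 n .$$ -/

import Mathlib

open MeasureTheory
open scoped ENNReal

noncomputable section

/-- Two measures on `ℝ^d` are affinely equivalent if an invertible affine map of `ℝ^d`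
carries one to the other. -/
def AffinelyEquivalent {d : ℕ} (D D' : Measure (EuclideanSpace ℝ (Fin d))) : Prop :=
  ∃ f : EuclideanSpace ℝ (Fin d) ≃ᵃ[ℝ] EuclideanSpace ℝ (Fin d), D' = D.map f

/-- Concentration: `Pr[‖x‖ > d α] ≤ c₁ / α` for all `α > 0`. -/
def Concentrated {d : ℕ} (D : Measure (EuclideanSpace ℝ (Fin d))) (c₁ : ℝ) : Prop :=
  ∀ α : ℝ, 0 < α → D {x | (d : ℝ) * α < ‖x‖} ≤ ENNReal.ofReal (c₁ / α)

/-- Anti-concentration: `Pr[|⟨x, v⟩ + b| ≤ α] ≤ c₂ α` for all `α > 0` and all hyperplanes,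
given by a unit normal vector `v` and an offset `b`. -/
def AntiConcentrated {d : ℕ} (D : Measure (EuclideanSpace ℝ (Fin d))) (c₂ : ℝ) : Prop :=
  ∀ α : ℝ, 0 < α → ∀ v : EuclideanSpace ℝ (Fin d), ‖v‖ = 1 → ∀ b : ℝ,
    D {x | |inner ℝ x v + b| ≤ α} ≤ ENNReal.ofReal (c₂ * α)

/-- `D` is affinely equivalent to a distribution that is concentrated with constant `c₁` and
anti-concentrated with constant `c₂`. -/
def WeaklyNice {d : ℕ} (D : Measure (EuclideanSpace ℝ (Fin d))) (c₁ c₂ : ℝ) : Prop :=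
  ∃ D' : Measure (EuclideanSpace ℝ (Fin d)),
    AffinelyEquivalent D D' ∧ Concentrated D' c₁ ∧ AntiConcentrated D' c₂

/-- The affine function `y ↦ ⟨h, y⟩ + b`. A vector `h` stands for the hyperplane
`{y | ⟨h, y⟩ + b = 0}`; `b` is a normalization shared by all hyperplanes of an arrangement
(`b = 0`: hyperplanes through the origin; `b = -1`: hyperplanes `⟨h, y⟩ = 1`). -/
def hyperplaneValue {d : ℕ} (b : ℝ) (h y : EuclideanSpace ℝ (Fin d)) : ℝ :=
  inner ℝ h y + b

/-- The cell of the arrangement `H` that contains `x`, recorded as the vector of positions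
(negative side, on the hyperplane, positive side) of `x` relative to the hyperplanes. Two points
lie in the same cell iff these vectors coincide. -/
def cellOf {d n : ℕ} (b : ℝ) (H : Fin n → EuclideanSpace ℝ (Fin d))
    (x : EuclideanSpace ℝ (Fin d)) : Fin n → SignType :=
  fun i => SignType.sign (hyperplaneValue b (H i) x)

/-- The admissible queries about an arrangement of `n` hyperplanes. -/
inductive ArrangementQuery (n : ℕ) : Type
  /-- On which side of the `i`-th hyperplane does `x` lie? -/
  | label (i : Fin n) : ArrangementQuery n
  /-- Which of the values of the `i`-th and `j`-th hyperplane functions at `x` is larger? -/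
  | comparison (i j : Fin n) : ArrangementQuery n

/-- The answer to a query: `sign (h_i x)` or `sign (h_i x - h_j x)`. -/
def ArrangementQuery.answer {d n : ℕ} (b : ℝ) (H : Fin n → EuclideanSpace ℝ (Fin d))
    (x : EuclideanSpace ℝ (Fin d)) : ArrangementQuery n → SignType
  | .label i => SignType.sign (hyperplaneValue b (H i) x)
  | .comparison i j => SignType.sign (hyperplaneValue b (H i) x - hyperplaneValue b (H j) x)

/-- (Deterministic) linear decision trees using only label and comparison queries: an inner node
asks a query and branches on its answer; a leaf outputs a cell. -/
inductive ComparisonLDT (n : ℕ) : Type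
  | leaf (cell : Fin n → SignType) : ComparisonLDT n
  | node (q : ArrangementQuery n) (child : SignType → ComparisonLDT n) : ComparisonLDT n

/-- The depth of a tree: the largest number of queries on a path from the root to a leaf. -/
def ComparisonLDT.depth {n : ℕ} : ComparisonLDT n → ℕ
  | .leaf _ => 0
  | .node _ child => (Finset.univ.sup fun s => (child s).depth) + 1

/-- The output of the tree on the point `x`, when the queries are about the arrangement `H`. -/
def ComparisonLDT.eval {d n : ℕ} (b : ℝ) (H : Fin n → EuclideanSpace ℝ (Fin d))
    (x : EuclideanSpace ℝ (Fin d)) : ComparisonLDT n → (Fin n → SignType)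
  | .leaf cell => cell
  | .node q child => (child (q.answer b H x)).eval b H x

/-- The tree solves point location for the arrangement `H`: it finds the cell of every point. -/
def ComparisonLDT.SolvesPointLocation {d n : ℕ} (T : ComparisonLDT n) (b : ℝ)
    (H : Fin n → EuclideanSpace ℝ (Fin d)) : Prop :=
  ∀ x : EuclideanSpace ℝ (Fin d), T.eval b H x = cellOf b H x

end

/-! For fixed `x`, the value `h_i(x)` is affine in `h_i`, so it equals `⟨p_i, w⟩ + t` with `p_i =
f(h_i)` the normalized points; the input enters only through `(w, t)`. Suppose the `p_i` lie in a
ball of radius `R` and every slab of half-width `β` holds fewer than `m` of them. Sort `m + q + 1`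
of the points with positive value. One of the `m` smallest values exceeds `β‖w‖`, hence so does the
next one. By pigeonhole on the `2 ^ q` subset sums of the later consecutive differences, some
difference plus a combination of earlier ones with coefficients at most `1` has norm at most `β`.
The next value therefore cannot fall to `0`: its sign is forced by the labels and comparisons of the
other points. Thus any `k = 3m + 2q + 1` hyperplanes contain one whose label follows from queries
within the rest (`exists_inferred`).

A bound `k` of this kind makes most `64k`-subsets of an index set `U` infer at least half of `U`
(`card_badSets_le`). The input matters only through its vector of answers, and there are at most
`(2(n + n²) + 1)^(d+1)` such vectors (`exists_representatives`), so a union bound gives one sample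
good for every `x` (`exists_sample`). The tree queries the labels of the sample, sorts it, discards
what is inferred, and repeats for `O(log n)` rounds, each costing `O(k log k)`.

For random arrangements, a union bound over a grid of slabs shows that the geometric hypothesis
fails with probability at most `2 / n` (`measure_bad_le`), with `m = O(d)` and `k = O(d (log n +
L))`. There the tree asks all `n` labels, which adds at most `2` to the expectation. -/

/-! ### Counting sign patterns of linear functionals -/

/-- The sign patterns that a list of linear functionals realizes on a submodule. -/
def signPatterns {V : Type*} [AddCommGroup V] [Module ℝ V] (W : Submodule ℝ V)
    (l : List (V →ₗ[ℝ] ℝ)) : Set (List SignType) :=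
  (fun v => l.map fun f => SignType.sign (f v)) '' (W : Set V)

theorem sign_combination {a b u v : ℝ} (ha : 0 < a) (hb : 0 < b)
    (h : SignType.sign u = SignType.sign v) :
    SignType.sign (a * u + b * v) = SignType.sign u := by
  rcases lt_trichotomy u 0 with hu | hu | hu
  · have hv : v < 0 := by rwa [sign_neg hu, eq_comm, sign_eq_neg_one_iff] at h
    rw [sign_neg hu, sign_eq_neg_one_iff]
    nlinarith [mul_neg_of_pos_of_neg ha hu, mul_neg_of_pos_of_neg hb hv]
  · have hv : v = 0 := by rwa [hu, sign_zero, eq_comm, sign_eq_zero_iff] at h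
    simp [hu, hv]
  · have hv : 0 < v := by rwa [sign_pos hu, eq_comm, sign_eq_one_iff] at h
    rw [sign_pos hu, sign_eq_one_iff]
    positivity

/-- Deletion and restriction. If a pattern of `l` occurs at two points of `W` with opposite signs of
`f`, a positive combination of them lies in `ker f` and keeps the pattern. So a pattern has a single
extension `σ φ` unless it survives on `W ⊓ ker f`; then `σ φ = 0` and the restriction accounts for
the two other signs. -/
theorem signPatterns_cons_subset {V : Type*} [AddCommGroup V] [Module ℝ V] (W : Submodule ℝ V)
    (f : V →ₗ[ℝ] ℝ) (l : List (V →ₗ[ℝ] ℝ)) :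
    ∃ σ : List SignType → SignType, signPatterns W (f :: l) ⊆
      (fun φ => σ φ :: φ) '' signPatterns W l ∪
      ((fun φ => (1 : SignType) :: φ) '' signPatterns (W ⊓ LinearMap.ker f) l ∪
       (fun φ => (-1 : SignType) :: φ) '' signPatterns (W ⊓ LinearMap.ker f) l) := by
  classical
  have key : ∀ φ : List SignType, ∃ τ : SignType, ∀ v ∈ W,
      (l.map fun f => SignType.sign (f v)) = φ → SignType.sign (f v) = τ ∨
        (φ ∈ signPatterns (W ⊓ LinearMap.ker f) l ∧ SignType.sign (f v) ≠ 0) := by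
    intro φ
    by_cases hφ : φ ∈ signPatterns (W ⊓ LinearMap.ker f) l
    · exact ⟨0, fun v _ _ => or_iff_not_imp_left.2 fun h => ⟨hφ, h⟩⟩
    by_cases hex : ∃ u ∈ W, (l.map fun f => SignType.sign (f u)) = φ
    · obtain ⟨u, hu, huφ⟩ := hex
      refine ⟨SignType.sign (f u), fun v hv hvφ => Or.inl ?_⟩
      by_contra hne
      have mem : ∀ x ∈ W, (l.map fun f => SignType.sign (f x)) = φ → f x ≠ 0 := by
        intro x hx hxφ h0
        exact hφ ⟨x, ⟨hx, h0⟩, hxφ⟩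
      have h1 := mem u hu huφ
      have h2 := mem v hv hvφ
      have comb : ∀ a b : ℝ, 0 < a → 0 < b → a * f u + b * f v ≠ 0 := by
        intro a b ha hb
        have := mem (a • u + b • v) (W.add_mem (W.smul_mem _ hu) (W.smul_mem _ hv)) (by
          rw [← huφ]
          rw [← hvφ] at huφ
          refine List.map_congr_left fun g hg => ?_
          have := List.map_inj_left.1 huφ g hg
          simp only [map_add, map_smul, smul_eq_mul]
          exact sign_combination ha hb this)
        simpa using this
      rcases lt_or_gt_of_ne h1 with hu' | hu' <;> rcases lt_or_gt_of_ne h2 with hv' | hv'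
      · exact hne (by rw [sign_neg hu', sign_neg hv'])
      · exact comb (f v) (-f u) hv' (by linarith) (by ring)
      · exact comb (-f v) (f u) (by linarith) hu' (by ring)
      · exact hne (by rw [sign_pos hu', sign_pos hv'])
    · exact ⟨0, fun v hv h => (hex ⟨v, hv, h⟩).elim⟩
  choose σ hσ using key
  refine ⟨σ, ?_⟩
  rintro _ ⟨v, hv, rfl⟩
  simp only [List.map_cons]
  rcases hσ _ v hv rfl with h | ⟨h, h0⟩
  · exact Or.inl ⟨_, ⟨v, hv, rfl⟩, by simp [h]⟩
  · right
    rcases lt_trichotomy (f v) 0 with h' | h' | h'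
    · exact Or.inr ⟨_, h, by simp [sign_neg h']⟩
    · simp [h'] at h0
    · exact Or.inl ⟨_, h, by simp [sign_pos h']⟩

theorem signPatterns_finite {V : Type*} [AddCommGroup V] [Module ℝ V] (W : Submodule ℝ V)
    (l : List (V →ₗ[ℝ] ℝ)) : (signPatterns W l).Finite := by
  induction l generalizing W with
  | nil => exact (Set.finite_singleton []).subset (by rintro _ ⟨v, -, rfl⟩; simp)
  | cons f l ih =>
    obtain ⟨σ, hσ⟩ := signPatterns_cons_subset W f l
    exact (((ih W).image _).union (((ih _).image _).union ((ih _).image _))).subset hσ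

/-- When `f` does not vanish on `W`, the restriction loses a dimension, and the recursion closes
because `(2m+1)^(D+1) + 2(2m+1)^D = (2m+1)^D (2m+3)`. -/
theorem ncard_signPatterns_le {V : Type*} [AddCommGroup V] [Module ℝ V] [FiniteDimensional ℝ V]
    (W : Submodule ℝ V) (l : List (V →ₗ[ℝ] ℝ)) :
    (signPatterns W l).ncard ≤ (2 * l.length + 1) ^ Module.finrank ℝ W := by
  induction l generalizing W with
  | nil =>
    refine (Set.ncard_le_ncard (t := {[]}) (by rintro _ ⟨v, -, rfl⟩; simp)).trans ?_
    simp
  | cons f l ih =>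
    by_cases hW : W ≤ LinearMap.ker f
    · have : signPatterns W (f :: l) ⊆ (fun φ => (0 : SignType) :: φ) '' signPatterns W l := by
        rintro _ ⟨v, hv, rfl⟩
        have : f v = 0 := hW hv
        exact ⟨_, ⟨v, hv, rfl⟩, by simp [this]⟩
      refine (Set.ncard_le_ncard this ((signPatterns_finite W l).image _)).trans ?_
      refine (Set.ncard_image_le (signPatterns_finite W l)).trans ((ih W).trans ?_)
      gcongr
      simp
    · obtain ⟨σ, hσ⟩ := signPatterns_cons_subset W f l
      have hfin := signPatterns_finite W l
      have hfin' := signPatterns_finite (W ⊓ LinearMap.ker f) l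
      have hlt : Module.finrank ℝ ↥(W ⊓ LinearMap.ker f) < Module.finrank ℝ W := by
        apply Submodule.finrank_lt_finrank_of_lt
        exact lt_of_le_of_ne inf_le_left fun h => hW (inf_eq_left.1 h)
      obtain ⟨D, hD⟩ : ∃ D, Module.finrank ℝ W = D + 1 := ⟨_, (Nat.succ_pred (by omega)).symm⟩
      have h1 := ih W
      have h2 : (signPatterns (W ⊓ LinearMap.ker f) l).ncard ≤ (2 * l.length + 1) ^ D :=
        (ih _).trans (Nat.pow_le_pow_right (by omega) (by omega))
      rw [hD] at h1 ⊢
      calc (signPatterns W (f :: l)).ncard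
          ≤ _ := Set.ncard_le_ncard hσ
            ((hfin.image _).union ((hfin'.image _).union (hfin'.image _)))
        _ ≤ (signPatterns W l).ncard + ((signPatterns (W ⊓ LinearMap.ker f) l).ncard +
            (signPatterns (W ⊓ LinearMap.ker f) l).ncard) := by
            refine (Set.ncard_union_le _ _).trans (add_le_add (Set.ncard_image_le hfin) ?_)
            exact (Set.ncard_union_le _ _).trans
              (add_le_add (Set.ncard_image_le hfin') (Set.ncard_image_le hfin'))
        _ ≤ (2 * l.length + 1) ^ (D + 1) + ((2 * l.length + 1) ^ D + (2 * l.length + 1) ^ D) := by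
            gcongr
        _ = (2 * l.length + 1) ^ D * (2 * (l.length + 1) + 1) := by ring
        _ ≤ (2 * (l.length + 1) + 1) ^ D * (2 * (l.length + 1) + 1) := by gcongr; omega
        _ = (2 * (f :: l).length + 1) ^ (D + 1) := by rw [List.length_cons, pow_succ]

/-- The affine function queried at a node, as a linear functional of `(x, 1)`. -/
noncomputable def ArrangementQuery.functional {d n : ℕ} (b : ℝ)
    (H : Fin n → EuclideanSpace ℝ (Fin d)) :
    ArrangementQuery n → (EuclideanSpace ℝ (Fin d) × ℝ →ₗ[ℝ] ℝ)
  | .label i => (innerₗ _ (H i)).coprod (b • LinearMap.id)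
  | .comparison i j => (innerₗ _ (H i - H j)).coprod 0

theorem ArrangementQuery.sign_functional {d n : ℕ} (b : ℝ)
    (H : Fin n → EuclideanSpace ℝ (Fin d)) (x : EuclideanSpace ℝ (Fin d))
    (q : ArrangementQuery n) :
    SignType.sign (q.functional b H (x, 1)) = q.answer b H x := by
  cases q with
  | label i => simp [functional, answer, hyperplaneValue]
  | comparison i j => simp [functional, answer, hyperplaneValue]

/-- Few points represent all vectors of answers to the admissible queries. -/
theorem exists_representatives {d n : ℕ} (b : ℝ) (H : Fin n → EuclideanSpace ℝ (Fin d)) :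
    ∃ X : Finset (EuclideanSpace ℝ (Fin d)), X.card ≤ (2 * (n + n * n) + 1) ^ (d + 1) ∧
      ∀ x, ∃ y ∈ X, ∀ q : ArrangementQuery n, q.answer b H y = q.answer b H x := by
  classical
  let qs : List (ArrangementQuery n) := (List.finRange n).map .label ++
    (List.finRange n ×ˢ List.finRange n).map fun ij => .comparison ij.1 ij.2
  have hqs : ∀ q, q ∈ qs := by
    intro q
    cases q <;> simp [qs]
  have hlen : (qs.map fun q => q.functional b H).length = n + n * n := by
    simp [qs, List.length_product]
  let pat : EuclideanSpace ℝ (Fin d) → List SignType := fun x => qs.map fun q => q.answer b H x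
  have hsub : Set.range pat ⊆ signPatterns ⊤ (qs.map fun q => q.functional b H) := by
    rintro _ ⟨x, rfl⟩
    refine ⟨(x, 1), trivial, ?_⟩
    simp only [List.map_map, pat]
    exact List.map_congr_left fun q _ => q.sign_functional b H x
  have hfin := (signPatterns_finite ⊤ (qs.map fun q => q.functional b H)).subset hsub
  have hcard : (Set.range pat).ncard ≤ (2 * (n + n * n) + 1) ^ (d + 1) := by
    refine (Set.ncard_le_ncard hsub (signPatterns_finite _ _)).trans ?_
    refine (ncard_signPatterns_le _ _).trans ?_
    rw [hlen]
    simp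
  refine ⟨hfin.toFinset.image (Function.invFun pat), ?_, fun x => ?_⟩
  · refine Finset.card_image_le.trans ?_
    rwa [← Set.ncard_eq_toFinset_card _ hfin]
  · refine ⟨Function.invFun pat (pat x), Finset.mem_image_of_mem _ (by simp), fun q => ?_⟩
    have : pat (Function.invFun pat (pat x)) = pat x := Function.invFun_eq ⟨x, rfl⟩
    exact List.map_inj_left.1 this q (hqs q)

/-! ### Samples that infer half of a set -/

section Sampling

variable {ι : Type*} [DecidableEq ι]

/-- The total weight of the orderings of a set: each element that is not inferred from its
predecessors costs a factor `1/2`. -/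
noncomputable def orderingWeight (inf : Finset ι → Finset ι) : ℕ → Finset ι → ℝ
  | 0, _ => 1
  | i + 1, S => ∑ y ∈ S, (if y ∈ inf (S.erase y) then 1 else 1 / 2) *
      orderingWeight inf i (S.erase y)

theorem orderingWeight_nonneg (inf : Finset ι → Finset ι) (i : ℕ) (S : Finset ι) :
    0 ≤ orderingWeight inf i S := by
  induction i generalizing S with
  | zero => simp [orderingWeight]
  | succ i ih =>
    refine Finset.sum_nonneg fun y _ => mul_nonneg ?_ (ih _)
    split_ifs <;> norm_num

/-- By monotonicity the uninferred elements stay uninferred when they are considered among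
themselves, so `k` of them would contradict `hk`. -/
theorem card_filter_not_inferred_lt {inf : Finset ι → Finset ι} (hmono : Monotone inf) {k : ℕ}
    (hk : ∀ S : Finset ι, k ≤ S.card → ∃ y ∈ S, y ∈ inf (S.erase y)) (S : Finset ι) :
    (S.filter fun y => y ∉ inf (S.erase y)).card < k := by
  by_contra! h
  obtain ⟨y, hy, hy'⟩ := hk _ h
  exact (Finset.mem_filter.1 hy).2
    (hmono (Finset.erase_subset_erase _ (Finset.filter_subset _ _)) hy')

/-- Fewer than `k` choices of the last element are uninferred, so the mean factor at size `i + 1` is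
at least `1 - k / (2(i + 1))`, which is at least `15/16` once `i ≥ 8k`. Each earlier step loses at
most `1/2`; these losses make up the power `min i (8 * k)`. -/
theorem le_orderingWeight {inf : Finset ι → Finset ι} (hmono : Monotone inf) {k : ℕ}
    (hk : ∀ S : Finset ι, k ≤ S.card → ∃ y ∈ S, y ∈ inf (S.erase y)) (i : ℕ) (S : Finset ι)
    (hS : S.card = i) :
    (i.factorial : ℝ) * (15 / 16) ^ i * (1 / 2) ^ min i (8 * k) ≤ orderingWeight inf i S := by
  induction i generalizing S with
  | zero => simp [orderingWeight]
  | succ i ih =>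
    set c : ℝ := (i.factorial : ℝ) * (15 / 16) ^ i * (1 / 2) ^ min i (8 * k) with hc
    have hc0 : 0 ≤ c := by positivity
    set B := S.filter fun y => y ∉ inf (S.erase y) with hB
    have h1 : (∑ y ∈ S, (if y ∈ inf (S.erase y) then (1 : ℝ) else 1 / 2)) =
        (i + 1 : ℝ) - B.card / 2 := by
      have : ∀ y ∈ S, (if y ∈ inf (S.erase y) then (1 : ℝ) else 1 / 2) =
          1 - (if y ∉ inf (S.erase y) then (1 : ℝ) else 0) / 2 := by
        intro y _
        split_ifs <;> norm_num
      rw [Finset.sum_congr rfl this, Finset.sum_sub_distrib, ← Finset.sum_div, Finset.sum_boole]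
      simp [hS, hB]
    have h2 : ((i + 1 : ℝ) - B.card / 2) * c ≤ orderingWeight inf (i + 1) S := by
      rw [← h1, Finset.sum_mul]
      refine Finset.sum_le_sum fun y hy => mul_le_mul_of_nonneg_left
        (ih _ (by rw [Finset.card_erase_of_mem hy, hS]; rfl)) ?_
      split_ifs <;> norm_num
    refine le_trans ?_ h2
    have hBk : (B.card : ℝ) ≤ k := by exact_mod_cast (card_filter_not_inferred_lt hmono hk S).le
    have hBi : (B.card : ℝ) ≤ i + 1 := by
      exact_mod_cast (Finset.card_filter_le _ _).trans hS.le
    have hf : ((i + 1).factorial : ℝ) = (i + 1) * i.factorial := by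
      push_cast [Nat.factorial_succ]; ring
    rcases Nat.lt_or_ge i (8 * k) with hik | hik
    · have : min (i + 1) (8 * k) = min i (8 * k) + 1 := by omega
      rw [this, hf, pow_succ, pow_succ (1 / 2 : ℝ)]
      have : ((i + 1 : ℝ) * (15 / 16) * (1 / 2)) * c ≤ ((i + 1 : ℝ) - B.card / 2) * c := by
        apply mul_le_mul_of_nonneg_right _ hc0
        have : (0 : ℝ) ≤ i := Nat.cast_nonneg i
        linarith
      refine le_trans (le_of_eq ?_) this
      rw [hc]; ring
    · have : min (i + 1) (8 * k) = min i (8 * k) := by omega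
      rw [this, hf, pow_succ]
      have : ((i + 1 : ℝ) * (15 / 16)) * c ≤ ((i + 1 : ℝ) - B.card / 2) * c := by
        apply mul_le_mul_of_nonneg_right _ hc0
        have : (8 * k : ℝ) ≤ i := by exact_mod_cast hik
        linarith
      refine le_trans (le_of_eq ?_) this
      rw [hc]; ring

/-- The sets that leave more than half of `U` without inference. -/
def badSets (inf : Finset ι → Finset ι) (U : Finset ι) (i : ℕ) : Finset (Finset ι) :=
  (U.powersetCard i).filter fun S => U.card < 2 * (U \ inf S).card

/-- Every prefix of an ordering of a bad set is bad, by monotonicity. More than half of `U` is then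
uninferred at each step, so the `|U| - i` possible next elements have total factor at most `|U| - i
- |U|/4 ≤ (3/4)(|U| - i)`. -/
theorem sum_orderingWeight_badSets_le {inf : Finset ι → Finset ι} (hmono : Monotone inf)
    (hself : ∀ S, S ⊆ inf S) (U : Finset ι) (i : ℕ) (hi : i ≤ U.card) :
    ∑ S ∈ badSets inf U i, orderingWeight inf i S ≤
      (3 / 4) ^ i * (U.card.descFactorial i : ℝ) := by
  induction i with
  | zero =>
    simp only [orderingWeight, Finset.sum_const, nsmul_eq_mul, mul_one, pow_zero,
      Nat.descFactorial_zero, Nat.cast_one]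
    exact_mod_cast (Finset.card_filter_le _ _).trans (by simp)
  | succ i ih =>
    have step : ∑ S ∈ badSets inf U (i + 1), orderingWeight inf (i + 1) S ≤
        ∑ T ∈ badSets inf U i, ∑ y ∈ U \ T,
          (if y ∈ inf T then (1 : ℝ) else 1 / 2) * orderingWeight inf i T := by
      simp only [orderingWeight]
      rw [Finset.sum_sigma', Finset.sum_sigma']
      -- The pair `(S, y)` is traded for `(S.erase y, y)`, injectively because `y ∈ S`. Pairs that
      -- are not reached contribute nonnegative terms.
      refine le_of_eq_of_le (b := ∑ a ∈ ((badSets inf U (i + 1)).sigma fun S => S).image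
        (fun a : (_ : Finset ι) × ι => (⟨a.1.erase a.2, a.2⟩ : (_ : Finset ι) × ι)),
          (if a.2 ∈ inf a.1 then (1 : ℝ) else 1 / 2) * orderingWeight inf i a.1) ?_ ?_
      · rw [Finset.sum_image]
        rintro ⟨S, y⟩ hS ⟨S', y'⟩ hS' h
        simp only [Finset.coe_sigma, Set.mem_sigma_iff, Finset.mem_coe] at hS hS'
        simp only [Sigma.mk.injEq, heq_eq_eq] at h ⊢
        obtain ⟨h1, rfl⟩ := h
        exact ⟨by rw [← Finset.insert_erase hS.2, h1, Finset.insert_erase hS'.2], rfl⟩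
      · refine Finset.sum_le_sum_of_subset_of_nonneg ?_ ?_
        · intro a ha
          obtain ⟨⟨S, y⟩, hS, rfl⟩ := Finset.mem_image.1 ha
          simp only [Finset.mem_sigma, badSets, Finset.mem_filter, Finset.mem_powersetCard] at hS
          obtain ⟨⟨⟨hSU, hcard⟩, hbad⟩, hy⟩ := hS
          simp only [Finset.mem_sigma, badSets, Finset.mem_filter, Finset.mem_powersetCard,
            Finset.mem_sdiff, Finset.mem_erase, ne_eq, not_true_eq_false, false_and,
            not_false_eq_true, and_true]
          refine ⟨⟨⟨(Finset.erase_subset _ _).trans hSU, ?_⟩, hbad.trans_le ?_⟩, hSU hy⟩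
          · rw [Finset.card_erase_of_mem hy, hcard]; rfl
          · gcongr
            exact hmono (Finset.erase_subset _ _)
        · intro a _ _
          refine mul_nonneg ?_ (orderingWeight_nonneg _ _ _)
          split_ifs <;> norm_num
    refine step.trans ?_
    have inner : ∀ T ∈ badSets inf U i, ∑ y ∈ U \ T,
        (if y ∈ inf T then (1 : ℝ) else 1 / 2) * orderingWeight inf i T ≤
          (3 / 4 * ((U.card : ℝ) - i)) * orderingWeight inf i T := by
      intro T hT
      simp only [badSets, Finset.mem_filter, Finset.mem_powersetCard] at hT
      obtain ⟨⟨hTU, hcard⟩, hbad⟩ := hT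
      rw [← Finset.sum_mul]
      refine mul_le_mul_of_nonneg_right ?_ (orderingWeight_nonneg _ _ _)
      have : ∀ y ∈ U \ T, (if y ∈ inf T then (1 : ℝ) else 1 / 2) =
          1 - (if y ∉ inf T then (1 : ℝ) else 0) / 2 := by
        intro y _
        split_ifs <;> norm_num
      rw [Finset.sum_congr rfl this, Finset.sum_sub_distrib, ← Finset.sum_div, Finset.sum_boole]
      have hset : (U \ T).filter (fun y => y ∉ inf T) = U \ inf T := by
        ext y
        simp only [Finset.mem_filter, Finset.mem_sdiff]
        exact ⟨fun h => ⟨h.1.1, h.2⟩, fun h => ⟨⟨h.1, fun hy => h.2 (hself T hy)⟩, h.2⟩⟩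
      have hc : ((U \ T).card : ℝ) = U.card - i := by
        rw [Finset.card_sdiff_of_subset hTU, hcard, Nat.cast_sub (by omega)]
      rw [hset]
      simp only [Finset.sum_const, nsmul_eq_mul, mul_one, hc]
      have : (U.card : ℝ) < 2 * (U \ inf T).card := by exact_mod_cast hbad
      have : (0 : ℝ) ≤ i := Nat.cast_nonneg i
      linarith
    refine (Finset.sum_le_sum inner).trans ?_
    rw [← Finset.mul_sum, Nat.descFactorial_succ, pow_succ]
    have hUi : (0 : ℝ) ≤ U.card - i := by
      have : (i : ℝ) ≤ U.card := by exact_mod_cast (Nat.le_succ i).trans hi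
      linarith
    calc 3 / 4 * ((U.card : ℝ) - i) * ∑ T ∈ badSets inf U i, orderingWeight inf i T
        ≤ 3 / 4 * ((U.card : ℝ) - i) * ((3 / 4) ^ i * (U.card.descFactorial i : ℝ)) :=
          mul_le_mul_of_nonneg_left (ih (by omega)) (by positivity)
      _ = _ := by
          rw [Nat.cast_mul, Nat.cast_sub (by omega)]; ring

/-- Comparison of the lower bound on each weight with the upper bound on their sum; `3/4 =
(4/5)(15/16)`. -/
theorem card_badSets_le {inf : Finset ι → Finset ι} (hmono : Monotone inf)
    (hself : ∀ S, S ⊆ inf S) {k : ℕ}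
    (hk : ∀ S : Finset ι, k ≤ S.card → ∃ y ∈ S, y ∈ inf (S.erase y))
    (U : Finset ι) (i : ℕ) (hi : i ≤ U.card) :
    ((badSets inf U i).card : ℝ) ≤ (4 / 5) ^ i * 2 ^ (8 * k) * (U.card.choose i : ℝ) := by
  have h1 := sum_orderingWeight_badSets_le hmono hself U i hi
  have h2 : ((badSets inf U i).card : ℝ) *
      ((i.factorial : ℝ) * (15 / 16) ^ i * (1 / 2) ^ (8 * k)) ≤
      ∑ S ∈ badSets inf U i, orderingWeight inf i S := by
    rw [← nsmul_eq_mul]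
    refine Finset.card_nsmul_le_sum _ _ _ fun S hS => ?_
    have hS' := (Finset.mem_powersetCard.1 (Finset.mem_filter.1 hS).1).2
    refine le_trans ?_ (le_orderingWeight hmono hk i S hS')
    refine mul_le_mul_of_nonneg_left ?_ (by positivity)
    exact pow_le_pow_of_le_one (by norm_num) (by norm_num) (min_le_right _ _)
  have h3 := h2.trans h1
  rw [Nat.descFactorial_eq_factorial_mul_choose, Nat.cast_mul] at h3
  have e1 : (3 / 4 : ℝ) ^ i = (4 / 5) ^ i * (15 / 16) ^ i := by
    rw [← mul_pow]; norm_num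
  have e2 : (2 : ℝ) ^ (8 * k) * (1 / 2) ^ (8 * k) = 1 := by
    rw [← mul_pow]; norm_num
  have hpos : (0 : ℝ) < (i.factorial : ℝ) * (15 / 16) ^ i * (1 / 2) ^ (8 * k) := by positivity
  refine le_of_mul_le_mul_right (h3.trans (le_of_eq ?_)) hpos
  rw [e1]
  linear_combination (-(4 / 5 : ℝ) ^ i * (15 / 16) ^ i * i.factorial * (U.card.choose i)) * e2

/-- One set of size `s` serves all inference operators of a small family. -/
theorem exists_sample {κ : Type*} (X : Finset κ) (inf : κ → Finset ι → Finset ι)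
    (hmono : ∀ c, Monotone (inf c)) (hself : ∀ c S, S ⊆ inf c S) {k : ℕ}
    (hk : ∀ c, ∀ S : Finset ι, k ≤ S.card → ∃ y ∈ S, y ∈ inf c (S.erase y))
    (U : Finset ι) (hU : 64 * k ≤ U.card) (hX : X.card < 2 ^ (12 * k)) :
    ∃ S ⊆ U, S.card = 64 * k ∧ ∀ c ∈ X, 2 * (U \ inf c S).card ≤ U.card := by
  by_contra! hcon
  have hsub : U.powersetCard (64 * k) ⊆ X.biUnion fun c => badSets (inf c) U (64 * k) := by
    intro S hS
    obtain ⟨c, hc, h⟩ := hcon S (Finset.mem_powersetCard.1 hS).1 (Finset.mem_powersetCard.1 hS).2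
    exact Finset.mem_biUnion.2 ⟨c, hc, Finset.mem_filter.2 ⟨hS, h⟩⟩
  have h1 : (U.card.choose (64 * k) : ℝ) ≤
      ∑ c ∈ X, ((badSets (inf c) U (64 * k)).card : ℝ) := by
    rw [← Finset.card_powersetCard]
    exact_mod_cast (Finset.card_le_card hsub).trans Finset.card_biUnion_le
  have h2 := h1.trans (Finset.sum_le_sum fun c _ =>
    card_badSets_le (hmono c) (hself c) (hk c) U (64 * k) hU)
  rw [Finset.sum_const, nsmul_eq_mul, ← mul_assoc] at h2
  have hpos : (0 : ℝ) < U.card.choose (64 * k) := by exact_mod_cast Nat.choose_pos hU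
  have h3 : (1 : ℝ) ≤ X.card * ((4 / 5) ^ (64 * k) * 2 ^ (8 * k)) := by
    by_contra! h
    nlinarith
  -- The sample size `64k` is chosen so that `(4/5)^64 * 2^8 ≤ 2^(-12)`, which beats fewer than
  -- `2^(12k)` operators.
  have h4 : (4 / 5 : ℝ) ^ (64 * k) * 2 ^ (8 * k) ≤ (1 / 2) ^ (12 * k) := by
    rw [pow_mul, pow_mul, pow_mul, ← mul_pow]
    exact pow_le_pow_left₀ (by positivity) (by norm_num) k
  have h5 : (X.card : ℝ) < 2 ^ (12 * k) := by exact_mod_cast hX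
  have h6 : (X.card : ℝ) * ((4 / 5) ^ (64 * k) * 2 ^ (8 * k)) ≤ X.card * (1 / 2) ^ (12 * k) :=
    mul_le_mul_of_nonneg_left h4 (Nat.cast_nonneg _)
  have h7 : (X.card : ℝ) * (1 / 2) ^ (12 * k) < 1 := by
    calc (X.card : ℝ) * (1 / 2) ^ (12 * k) < 2 ^ (12 * k) * (1 / 2) ^ (12 * k) :=
          mul_lt_mul_of_pos_right h5 (by positivity)
      _ = 1 := by rw [← mul_pow]; norm_num
  linarith

end Sampling

/-! ### Forced labels for points without crowded slabs -/

theorem euclidean_norm_le_of_coord_le {d : ℕ} (z : EuclideanSpace ℝ (Fin d)) {r : ℝ}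
    (h : ∀ i, |z i| ≤ r) : ‖z‖ ≤ d * r := by
  rw [EuclideanSpace.norm_eq]
  refine (Real.sqrt_le_left (Finset.sum_nonneg fun i _ => norm_nonneg (z i))).2 ?_ |>.trans
    (b := ∑ i, ‖z i‖) ?_
  · exact Finset.sum_sq_le_sq_sum_of_nonneg fun i _ => norm_nonneg _
  · refine (Finset.sum_le_card_nsmul _ _ r fun i _ => h i).trans ?_
    simp

theorem floor_div_mem_Icc {x s : ℝ} {A : ℕ} (hs : 0 < s) (h : |x| ≤ A * s) :
    ⌊x / s⌋ ∈ Finset.Icc (-(A : ℤ)) A := by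
  have h1 := abs_le.1 h
  rw [Finset.mem_Icc]
  constructor
  · rw [Int.le_floor, le_div_iff₀ hs]
    push_cast
    linarith
  · have : x / s ≤ A := by rw [div_le_iff₀ hs]; exact h1.2
    exact_mod_cast (Int.floor_le _).trans this

theorem abs_sub_le_of_floor_div_eq {x y s : ℝ} (hs : 0 < s) (h : ⌊x / s⌋ = ⌊y / s⌋) :
    |x - y| ≤ s := by
  have := Int.abs_sub_lt_one_of_floor_eq_floor h
  rw [← sub_div, abs_div, abs_of_pos hs, div_lt_one hs] at this
  exact this.le

/-- Among `2 ^ q` subset sums in a box covered by fewer than `2 ^ q` cells, two nearly agree. -/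
theorem exists_small_signed_sum {d q A : ℕ} (v : ℕ → EuclideanSpace ℝ (Fin d)) {r β : ℝ}
    (hd : 1 ≤ d) (hr : 0 ≤ r) (hβ : 0 < β) (hv : ∀ i < q, ‖v i‖ ≤ r) (hA : q * r * d ≤ A * β)
    (hcard : (2 * A + 1) ^ d < 2 ^ q) :
    ∃ j < q, ∃ δ : ℕ → ℝ, (∀ i, δ i ≤ 1) ∧ ‖v j + ∑ i ∈ Finset.range j, δ i • v i‖ ≤ β := by
  classical
  have hd0 : (0 : ℝ) < d := by exact_mod_cast hd
  have hs : 0 < β / d := div_pos hβ hd0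
  -- Cubes of side `β / d`: the crude bound of the norm by `d` times the largest coordinate puts two
  -- points of one cube at distance at most `β`.
  let cell : Finset ℕ → (Fin d → ℤ) := fun T c => ⌊(∑ i ∈ T, v i) c / (β / d)⌋
  have hmaps : ∀ T ∈ (Finset.range q).powerset,
      cell T ∈ Fintype.piFinset fun _ : Fin d => Finset.Icc (-(A : ℤ)) A := by
    intro T hT
    rw [Fintype.mem_piFinset]
    intro c
    refine floor_div_mem_Icc hs ?_
    have h1 : ‖∑ i ∈ T, v i‖ ≤ q * r := by
      have hT' := Finset.mem_powerset.1 hT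
      refine (norm_sum_le _ _).trans ((Finset.sum_le_card_nsmul _ _ r fun i hi =>
        hv i (Finset.mem_range.1 (hT' hi))).trans ?_)
      rw [nsmul_eq_mul]
      gcongr
      exact_mod_cast (Finset.card_le_card hT').trans (by simp)
    have h2 := (PiLp.norm_apply_le (∑ i ∈ T, v i) c).trans h1
    rw [Real.norm_eq_abs] at h2
    refine h2.trans ?_
    rw [← mul_div_assoc, le_div_iff₀ hd0]
    exact hA
  have hlt : (Fintype.piFinset fun _ : Fin d => Finset.Icc (-(A : ℤ)) A).card <
      ((Finset.range q).powerset).card := by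
    rw [Fintype.card_piFinset, Finset.card_powerset, Finset.card_range]
    simp only [Int.card_Icc, Finset.prod_const, Finset.card_univ, Fintype.card_fin]
    convert hcard using 2
    omega
  obtain ⟨S, hS, T, hT, hne, heq⟩ := Finset.exists_ne_map_eq_of_card_lt_of_maps_to hlt hmaps
  -- Stated for ordered pairs, since either set may contain the largest index `j` of the symmetric
  -- difference. The difference of indicators is then `1` at `j` and `0` beyond it.
  have main : ∀ S T : Finset ℕ, S ⊆ Finset.range q → T ⊆ Finset.range q → cell S = cell T →
      ∀ j, j ∈ S → j ∉ T → (∀ i, j < i → (i ∈ S ↔ i ∈ T)) →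
      ∃ j < q, ∃ δ : ℕ → ℝ, (∀ i, δ i ≤ 1) ∧ ‖v j + ∑ i ∈ Finset.range j, δ i • v i‖ ≤ β := by
    intro S T hS hT heq j hjS hjT hj
    have hjq : j < q := Finset.mem_range.1 (hS hjS)
    let δ : ℕ → ℝ := fun i => (if i ∈ S then 1 else 0) - (if i ∈ T then 1 else 0)
    refine ⟨j, hjq, δ, fun i => ?_, ?_⟩
    · simp only [δ]
      split_ifs <;> norm_num
    · have hsum : v j + ∑ i ∈ Finset.range j, δ i • v i = ∑ i ∈ S, v i - ∑ i ∈ T, v i := by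
        have hexp : ∀ S ⊆ Finset.range q, ∑ i ∈ S, v i =
            ∑ i ∈ Finset.range q, (if i ∈ S then (1 : ℝ) else 0) • v i := by
          intro S hS
          simp only [ite_smul, one_smul, zero_smul]
          rw [← Finset.sum_filter]
          congr 1
          ext i
          simp only [Finset.mem_filter]
          exact ⟨fun h => ⟨hS h, h⟩, fun h => h.2⟩
        rw [hexp S hS, hexp T hT, ← Finset.sum_sub_distrib]
        simp only [← sub_smul]
        have : ∑ i ∈ Finset.range (j + 1), δ i • v i = ∑ i ∈ Finset.range q, δ i • v i := by
          refine Finset.sum_subset (fun i hi => ?_) fun i _ hi => ?_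
          · simp only [Finset.mem_range] at hi ⊢; omega
          · simp only [Finset.mem_range, not_lt] at hi
            have := hj i (by omega)
            simp [δ, this]
        refine Eq.trans ?_ this
        rw [Finset.sum_range_succ, add_comm]
        simp [δ, hjS, hjT]
      rw [hsum]
      refine (euclidean_norm_le_of_coord_le (r := β / d) _ fun c => ?_).trans
        (le_of_eq (by field_simp))
      exact abs_sub_le_of_floor_div_eq hs (congrFun heq c)
  have hdiff : (symmDiff S T).Nonempty := by
    rw [Finset.nonempty_iff_ne_empty]
    exact fun h => hne (symmDiff_eq_bot.1 h)
  have hmax := Finset.max'_mem _ hdiff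
  have hle : ∀ i, (symmDiff S T).max' hdiff < i → (i ∈ S ↔ i ∈ T) := by
    intro i hi
    have : i ∉ symmDiff S T := fun h => (Finset.le_max' _ _ h).not_gt hi
    rw [Finset.mem_symmDiff] at this
    tauto
  rw [Finset.mem_powerset] at hS hT
  rcases Finset.mem_symmDiff.1 hmax with h | h
  · exact main S T hS hT heq _ h.1 h.2 hle
  · exact main T S hT hS heq.symm _ h.1 h.2 fun i hi => (hle i hi).symm

theorem exists_sorted_enumeration {ι : Type*} (P : Finset ι) (hP : P.Nonempty) (g : ι → ℝ) :
    ∃ y : ℕ → ι, (∀ i < P.card, y i ∈ P) ∧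
      (∀ i < P.card, ∀ j < P.card, y i = y j → i = j) ∧
      (∀ i j, i ≤ j → j < P.card → g (y i) ≤ g (y j)) := by
  obtain ⟨p₀, hp₀⟩ := hP
  let e := P.equivFin.symm
  let τ := Tuple.sort fun i => g (e i)
  refine ⟨fun i => if h : i < P.card then e (τ ⟨i, h⟩) else p₀, ?_, ?_, ?_⟩
  · intro i hi
    simp [hi]
  · intro i hi j hj h
    simpa [hi, hj] using h
  · intro i j hij hj
    simp only [hij.trans_lt hj, hj, dif_pos]
    exact Tuple.monotone_sort (fun i => g (e i)) (show (⟨i, _⟩ : Fin _) ≤ ⟨j, hj⟩ from hij)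

/-- Every slab of half-width `β` contains fewer than `m` of the points. -/
def ThinSlabs {d n : ℕ} (p : Fin n → EuclideanSpace ℝ (Fin d)) (β : ℝ) (m : ℕ) : Prop :=
  ∀ w : EuclideanSpace ℝ (Fin d), ‖w‖ = 1 → ∀ t : ℝ, ∀ J : Finset (Fin n),
    (∀ i ∈ J, |inner ℝ (p i) w + t| ≤ β) → J.card < m

theorem ThinSlabs.exists_lt {d n : ℕ} {p : Fin n → EuclideanSpace ℝ (Fin d)} {β : ℝ} {m : ℕ}
    (h : ThinSlabs p β m) {w : EuclideanSpace ℝ (Fin d)} (hw : w ≠ 0) (t : ℝ)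
    (J : Finset (Fin n)) (hJ : m ≤ J.card) : ∃ i ∈ J, β * ‖w‖ < |inner ℝ (p i) w + t| := by
  by_contra! hcon
  have hw' : 0 < ‖w‖ := norm_pos_iff.2 hw
  refine (h (‖w‖⁻¹ • w) (by rw [norm_smul, norm_inv, norm_norm, inv_mul_cancel₀ hw'.ne'])
    (‖w‖⁻¹ * t) J fun i hi => ?_).not_ge hJ
  rw [inner_smul_right, ← mul_add, abs_mul, abs_of_pos (inv_pos.2 hw'), inv_mul_le_iff₀ hw',
    mul_comm]
  exact hcon i hi

section Inference

variable {d n : ℕ} {p : Fin n → EuclideanSpace ℝ (Fin d)} {R β : ℝ} {m q A : ℕ}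

/-- With `z` the short vector, the last step is `⟨z, w⟩ - ∑ δ_i Δ_i`, where the earlier steps `Δ_i`
are nonnegative. As `δ_i ≤ 1`, it is at least `-β‖w‖` minus the total rise since index `m`; so the
inferred value is at least the value at index `m` minus `β‖w‖`, which is positive. -/
theorem exists_inferred_pos (hd : 1 ≤ d) (hR0 : 0 ≤ R) (hR : ∀ i, ‖p i‖ ≤ R) (hβ : 0 < β)
    (hm : 1 ≤ m) (hslab : ThinSlabs p β m) (hA : q * (2 * R) * d ≤ A * β)
    (hcard : (2 * A + 1) ^ d < 2 ^ q)
    (g : Fin n → ℝ) (P : Finset (Fin n)) (hP : m + q + 1 ≤ P.card) :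
    ∃ i ∈ P, ∀ (w : EuclideanSpace ℝ (Fin d)) (t : ℝ),
      (∀ j ∈ P.erase i, 0 < inner ℝ (p j) w + t) →
      (∀ j ∈ P.erase i, ∀ l ∈ P.erase i, g j ≤ g l → inner ℝ (p j) w + t ≤ inner ℝ (p l) w + t) →
      0 < inner ℝ (p i) w + t := by
  classical
  obtain ⟨y, hyP, hyinj, hymono⟩ := exists_sorted_enumeration P
    (Finset.card_pos.1 (by omega)) g
  -- The differences begin at index `m`: the `m` smallest points are reserved for the slab argument
  -- in `hbase`.
  obtain ⟨j, hj, δ, hδ, hz⟩ := exists_small_signed_sum (q := q)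
    (fun i => p (y (m + i + 1)) - p (y (m + i))) hd (mul_nonneg zero_le_two hR0) hβ
    (fun i _ => (norm_sub_le _ _).trans (by linarith [hR (y (m + i + 1)), hR (y (m + i))]))
    hA hcard
  refine ⟨y (m + j + 1), hyP _ (by omega), fun w t hpos hcmp => ?_⟩
  have hmem : ∀ i ≤ m + j, y i ∈ P.erase (y (m + j + 1)) := fun i hi =>
    Finset.mem_erase.2 ⟨fun h => by have := hyinj i (by omega) _ (by omega) h; omega,
      hyP i (by omega)⟩
  set g' : ℕ → ℝ := fun i => inner ℝ (p (y i)) w + t with hg'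
  have hmono' : ∀ i i', i ≤ i' → i' ≤ m + j → g' i ≤ g' i' := fun i i' h h' =>
    hcmp _ (hmem i (h.trans h')) _ (hmem i' h') (hymono i i' h (by omega))
  have hbase : β * ‖w‖ < g' m := by
    by_cases hw : w = 0
    · simpa [hw, hg'] using hpos _ (hmem m (by omega))
    · obtain ⟨i, hi, hlt⟩ := hslab.exists_lt hw t ((Finset.range m).image y) (by
        rw [Finset.card_image_of_injOn, Finset.card_range]
        intro a ha b hb h
        simp only [Finset.coe_range, Set.mem_Iio] at ha hb
        exact hyinj a (by omega) b (by omega) h)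
      obtain ⟨a, ha, rfl⟩ := Finset.mem_image.1 hi
      have ha' := Finset.mem_range.1 ha
      rw [abs_of_pos (hpos _ (hmem a (by omega)))] at hlt
      exact hlt.trans_le (hmono' a m ha'.le (by omega))
  have hinner : inner ℝ (p (y (m + j + 1)) - p (y (m + j)) +
      ∑ i ∈ Finset.range j, δ i • (p (y (m + i + 1)) - p (y (m + i)))) w =
      g' (m + j + 1) - g' (m + j) + ∑ i ∈ Finset.range j, δ i * (g' (m + i + 1) - g' (m + i)) := by
    simp only [inner_add_left, inner_sub_left, sum_inner, real_inner_smul_left, hg',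
      add_sub_add_right_eq_sub]
  have htele : g' (m + j) - g' m =
      ∑ i ∈ Finset.range j, (g' (m + i + 1) - g' (m + i)) :=
    (Finset.sum_range_sub (fun i => g' (m + i)) j).symm
  have hsum : ∑ i ∈ Finset.range j, δ i * (g' (m + i + 1) - g' (m + i)) ≤
      ∑ i ∈ Finset.range j, (g' (m + i + 1) - g' (m + i)) := by
    refine Finset.sum_le_sum fun i hi => ?_
    have hi' := Finset.mem_range.1 hi
    have := hmono' (m + i) (m + i + 1) (by omega) (by omega)
    exact mul_le_of_le_one_left (by linarith) (hδ i)
  have hcs := (abs_le.1 ((abs_real_inner_le_norm _ w).trans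
    (mul_le_mul_of_nonneg_right hz (norm_nonneg w)))).1
  rw [hinner] at hcs
  change 0 < g' (m + j + 1)
  linarith

/-- Three sign classes of sizes at most `m`, `m + q` and `m + q` cannot cover `S`. If `m` other
values vanish, thin slabs force `w = 0`, so the function is constant and equal to `0`. The negative
class reduces to the positive one through `(-w, -t)`. -/
theorem exists_inferred (hd : 1 ≤ d) (hR0 : 0 ≤ R) (hR : ∀ i, ‖p i‖ ≤ R) (hβ : 0 < β)
    (hm : 1 ≤ m) (hslab : ThinSlabs p β m) (hA : q * (2 * R) * d ≤ A * β)
    (hcard : (2 * A + 1) ^ d < 2 ^ q) (g : Fin n → ℝ)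
    (S : Finset (Fin n)) (hS : 3 * m + 2 * q + 1 ≤ S.card) :
    ∃ i ∈ S, ∀ (w : EuclideanSpace ℝ (Fin d)) (t : ℝ),
      (∀ j ∈ S.erase i, SignType.sign (inner ℝ (p j) w + t) = SignType.sign (g j)) →
      (∀ j ∈ S.erase i, ∀ l ∈ S.erase i,
        SignType.sign ((inner ℝ (p j) w + t) - (inner ℝ (p l) w + t)) =
          SignType.sign (g j - g l)) →
      SignType.sign (inner ℝ (p i) w + t) = SignType.sign (g i) := by
  classical
  have hsplit : (S.filter fun i => g i = 0).card + (S.filter fun i => 0 < g i).card +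
      (S.filter fun i => g i < 0).card = S.card := by
    have h1 := Finset.card_filter_add_card_filter_not (s := S) fun i => g i = 0
    have h2 := Finset.card_filter_add_card_filter_not (s := S.filter fun i => ¬ g i = 0)
      fun i => 0 < g i
    rw [Finset.filter_filter, Finset.filter_filter] at h2
    have e1 : (S.filter fun i => ¬ g i = 0 ∧ 0 < g i) = S.filter fun i => 0 < g i :=
      Finset.filter_congr fun i _ => ⟨fun h => h.2, fun h => ⟨h.ne', h⟩⟩
    have e2 : (S.filter fun i => ¬ g i = 0 ∧ ¬ 0 < g i) = S.filter fun i => g i < 0 :=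
      Finset.filter_congr fun i _ =>
        ⟨fun h => lt_of_le_of_ne (not_lt.1 h.2) h.1, fun h => ⟨h.ne, h.not_gt⟩⟩
    rw [e1, e2] at h2
    omega
  have hcase : m + 1 ≤ (S.filter fun i => g i = 0).card ∨
      m + q + 1 ≤ (S.filter fun i => 0 < g i).card ∨
      m + q + 1 ≤ (S.filter fun i => g i < 0).card := by omega
  rcases hcase with h | h | h
  · obtain ⟨i, hi⟩ := Finset.card_pos.1 (show 0 < (S.filter fun i => g i = 0).card by omega)
    refine ⟨i, (Finset.mem_filter.1 hi).1, fun w t hlab _ => ?_⟩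
    have hc : m ≤ ((S.filter fun i => g i = 0).erase i).card := by
      rw [Finset.card_erase_of_mem hi]; omega
    have hzero : ∀ j ∈ (S.filter fun i => g i = 0).erase i, inner ℝ (p j) w + t = 0 := by
      intro j hj
      rw [Finset.mem_erase, Finset.mem_filter] at hj
      have := hlab j (Finset.mem_erase.2 ⟨hj.1, hj.2.1⟩)
      rwa [hj.2.2, sign_zero, sign_eq_zero_iff] at this
    have hw : w = 0 := by
      by_contra hw
      obtain ⟨j, hj, hlt⟩ := hslab.exists_lt hw t _ hc
      rw [hzero j hj, abs_zero] at hlt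
      exact absurd hlt (not_lt.2 (by positivity))
    obtain ⟨j, hj⟩ := Finset.card_pos.1 (show
      0 < ((S.filter fun i => g i = 0).erase i).card by omega)
    have := hzero j hj
    rw [(Finset.mem_filter.1 hi).2]
    simp only [hw, inner_zero_right] at this ⊢
    rw [this]
  · obtain ⟨i, hi, hinf⟩ := exists_inferred_pos hd hR0 hR hβ hm hslab hA hcard g _ h
    rw [Finset.mem_filter] at hi
    have hsub : ∀ j ∈ (S.filter fun i => 0 < g i).erase i, j ∈ S.erase i ∧ 0 < g j := by
      intro j hj
      rw [Finset.mem_erase, Finset.mem_filter] at hj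
      exact ⟨Finset.mem_erase.2 ⟨hj.1, hj.2.1⟩, hj.2.2⟩
    refine ⟨i, hi.1, fun w t hlab hcmp => ?_⟩
    rw [sign_pos hi.2, sign_eq_one_iff]
    refine hinf w t (fun j hj => ?_) fun j hj l hl hjl => ?_
    · have := hlab j (hsub j hj).1
      rwa [sign_pos (hsub j hj).2, sign_eq_one_iff] at this
    · have := hcmp l (hsub l hl).1 j (hsub j hj).1
      by_contra! hlt
      rw [sign_neg (by linarith), eq_comm, sign_eq_neg_one_iff] at this
      linarith
  · obtain ⟨i, hi, hinf⟩ := exists_inferred_pos hd hR0 hR hβ hm hslab hA hcard (fun i => -g i) _ h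
    rw [Finset.mem_filter] at hi
    have hsub : ∀ j ∈ (S.filter fun i => g i < 0).erase i, j ∈ S.erase i ∧ g j < 0 := by
      intro j hj
      rw [Finset.mem_erase, Finset.mem_filter] at hj
      exact ⟨Finset.mem_erase.2 ⟨hj.1, hj.2.1⟩, hj.2.2⟩
    refine ⟨i, hi.1, fun w t hlab hcmp => ?_⟩
    rw [sign_neg hi.2, sign_eq_neg_one_iff]
    have := hinf (-w) (-t) (fun j hj => ?_) fun j hj l hl hjl => ?_
    · rw [inner_neg_right] at this
      linarith
    · have := hlab j (hsub j hj).1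
      rw [sign_neg (hsub j hj).2, sign_eq_neg_one_iff] at this
      rw [inner_neg_right]
      linarith
    · have := hcmp l (hsub l hl).1 j (hsub j hj).1
      rw [inner_neg_right, inner_neg_right]
      by_contra! hlt
      rw [sign_pos (by linarith), eq_comm, sign_eq_one_iff] at this
      linarith

end Inference

/-! ### Random points are bounded and have thin slabs -/

section Probability

theorem pi_forall_mem_eq {E : Type*} [MeasurableSpace E] {n : ℕ} (D : Measure E)
    [IsProbabilityMeasure D] (J : Finset (Fin n)) (s : Set E) :
    (Measure.pi fun _ : Fin n => D) {H | ∀ i ∈ J, H i ∈ s} = D s ^ J.card := by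
  classical
  have : {H : Fin n → E | ∀ i ∈ J, H i ∈ s} =
      Set.pi Set.univ fun i => if i ∈ J then s else Set.univ := by
    ext H
    simp only [Set.mem_ofPred_eq, Set.mem_pi, Set.mem_univ, forall_true_left]
    refine forall_congr' fun i => ?_
    split_ifs with h <;> simp [h]
  rw [this, Measure.pi_pi]
  have h2 : ∀ i : Fin n, D (if i ∈ J then s else Set.univ) = if i ∈ J then D s else 1 := by
    intro i
    split_ifs <;> simp
  simp only [h2, Finset.prod_ite_mem, Finset.univ_inter, Finset.prod_const]

variable {d n : ℕ} (D : Measure (EuclideanSpace ℝ (Fin d))) [IsProbabilityMeasure D]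
  (f : EuclideanSpace ℝ (Fin d) → EuclideanSpace ℝ (Fin d))

theorem measure_exists_norm_gt_le {c R : ℝ}
    (h : D {x | R < ‖f x‖} ≤ ENNReal.ofReal c) :
    (Measure.pi fun _ : Fin n => D) {H | ∃ i, R < ‖f (H i)‖} ≤ n * ENNReal.ofReal c := by
  have hset : {H : Fin n → EuclideanSpace ℝ (Fin d) | ∃ i, R < ‖f (H i)‖} =
      ⋃ i, {H | ∀ j ∈ ({i} : Finset (Fin n)), H j ∈ {x | R < ‖f x‖}} := by
    ext H
    simp
  rw [hset]
  refine (measure_iUnion_fintype_le _ _).trans ?_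
  simp only [pi_forall_mem_eq, Finset.card_singleton, pow_one, Finset.sum_const,
    Finset.card_univ, Fintype.card_fin, nsmul_eq_mul]
  gcongr

/-- Within a cell, `w` moves by at most `β / R` and `t` by at most `β`, so each changes the value by
at most `β`. -/
theorem inner_grid_le {w w' p : EuclideanSpace ℝ (Fin d)} {t t' R β : ℝ} (hd : 1 ≤ d)
    (hR : 0 < R) (hβ : 0 < β) (hp : ‖p‖ ≤ R)
    (hw : (fun c => ⌊w c / (β / (R * d))⌋) = fun c => ⌊w' c / (β / (R * d))⌋)
    (ht : ⌊t / β⌋ = ⌊t' / β⌋) (h : |inner ℝ p w + t| ≤ β) : |inner ℝ p w' + t'| ≤ 3 * β := by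
  have hd0 : (0 : ℝ) < d := by exact_mod_cast hd
  have h1 : ‖w' - w‖ ≤ β / R := by
    refine (euclidean_norm_le_of_coord_le (r := β / (R * d)) _ fun c => ?_).trans
      (le_of_eq (by field_simp))
    exact abs_sub_le_of_floor_div_eq (by positivity) (congrFun hw c).symm
  have h2 : |inner ℝ p (w' - w)| ≤ β := by
    refine (abs_real_inner_le_norm _ _).trans ?_
    calc ‖p‖ * ‖w' - w‖ ≤ R * (β / R) := by gcongr
      _ = β := by field_simp
  have h3 : |t' - t| ≤ β := abs_sub_le_of_floor_div_eq hβ ht.symm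
  rw [inner_sub_right] at h2
  rw [abs_le] at *
  constructor <;> linarith

/-- Inside the ball of radius `R`, all slabs of a cell lie in one slab of half-width `3β`, centred
on a pair `(w, t)` of that cell with `‖w‖ = 1`. Independence gives `c ^ m` for `m` given points to
fall into it; the union runs over the cells and the `m`-subsets of indices. -/
theorem measure_not_thinSlabs_le {R β c : ℝ} {A m : ℕ} (hd : 1 ≤ d) (hm : 1 ≤ m)
    (hR : 0 < R) (hβ : 0 < β)
    (hc : ∀ v : EuclideanSpace ℝ (Fin d), ‖v‖ = 1 → ∀ t : ℝ,
      D {x | |inner ℝ (f x) v + t| ≤ 3 * β} ≤ ENNReal.ofReal c)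
    (hA : R * d ≤ A * β) (hA' : R + β ≤ A * β) :
    (Measure.pi fun _ : Fin n => D)
        {H | (∀ i, ‖f (H i)‖ ≤ R) ∧ ¬ ThinSlabs (fun i => f (H i)) β m} ≤
      ((2 * A + 1) ^ (d + 1) * n ^ m : ℕ) * ENNReal.ofReal c ^ m := by
  classical
  have hd0 : (0 : ℝ) < d := by exact_mod_cast hd
  let cell : EuclideanSpace ℝ (Fin d) × ℝ → (Fin d → ℤ) × ℤ := fun θ =>
    (fun i => ⌊θ.1 i / (β / (R * d))⌋, ⌊θ.2 / β⌋)
  let box : Finset ((Fin d → ℤ) × ℤ) :=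
    (Fintype.piFinset fun _ : Fin d => Finset.Icc (-(A : ℤ)) A) ×ˢ Finset.Icc (-(A : ℤ)) A
  have hbox : box.card = (2 * A + 1) ^ (d + 1) := by
    have : (A + 1 + (A : ℤ)).toNat = 2 * A + 1 := by omega
    simp [box, Finset.card_product, pow_succ, this]
  have hslab : ∀ γ : (Fin d → ℤ) × ℤ, ∃ s : Set (EuclideanSpace ℝ (Fin d)),
      D s ≤ ENNReal.ofReal c ∧ ∀ w : EuclideanSpace ℝ (Fin d), ‖w‖ = 1 → ∀ t, cell (w, t) = γ →
        ∀ x, ‖f x‖ ≤ R → |inner ℝ (f x) w + t| ≤ β → x ∈ s := by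
    intro γ
    by_cases h : ∃ w : EuclideanSpace ℝ (Fin d), ‖w‖ = 1 ∧ ∃ t, cell (w, t) = γ
    · obtain ⟨w, hw, t, hγ⟩ := h
      refine ⟨_, hc w hw t, fun w' _ t' hγ' x hx hxs => ?_⟩
      rw [← hγ, Prod.ext_iff] at hγ'
      exact inner_grid_le hd hR hβ hx hγ'.1 hγ'.2 hxs
    · exact ⟨∅, by simp, fun w hw t hγ => (h ⟨w, hw, t, hγ⟩).elim⟩
  choose s hs hs' using hslab
  have hsub : {H : Fin n → EuclideanSpace ℝ (Fin d) |
      (∀ i, ‖f (H i)‖ ≤ R) ∧ ¬ ThinSlabs (fun i => f (H i)) β m} ⊆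
      ⋃ γ ∈ box, ⋃ J ∈ Finset.powersetCard m (Finset.univ : Finset (Fin n)),
        {H | ∀ i ∈ J, H i ∈ s γ} := by
    rintro H ⟨hnorm, hthin⟩
    simp only [ThinSlabs] at hthin
    push Not at hthin
    obtain ⟨w, hw, t, J, hJ, hcard⟩ := hthin
    obtain ⟨J', hJ', hcard'⟩ := Finset.exists_subset_card_eq hcard
    obtain ⟨i, hi⟩ := Finset.card_pos.1 (show 0 < J'.card by omega)
    -- A slab that meets the ball has bounded offset, so finitely many cells suffice; the point in
    -- it exists because `m ≥ 1`.
    have ht : |t| ≤ R + β := by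
      have h1 := hJ i (hJ' hi)
      have h2 : |inner ℝ (f (H i)) w| ≤ R := (abs_real_inner_le_norm (f (H i)) w).trans
        (by rw [hw, mul_one]; exact hnorm i)
      rw [abs_le] at *
      constructor <;> linarith
    simp only [Set.mem_iUnion]
    refine ⟨cell (w, t), ?_, J', Finset.mem_powersetCard.2 ⟨Finset.subset_univ _, hcard'⟩,
      fun i hi => hs' _ w hw t rfl _ (hnorm i) (hJ i (hJ' hi))⟩
    refine Finset.mem_product.2 ⟨Fintype.mem_piFinset.2 fun i => ?_, ?_⟩
    · refine floor_div_mem_Icc (by positivity) ?_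
      have := PiLp.norm_apply_le w i
      rw [Real.norm_eq_abs, hw] at this
      refine this.trans ?_
      rw [mul_div_assoc', le_div_iff₀ (by positivity), one_mul]
      exact hA
    · exact floor_div_mem_Icc hβ (ht.trans hA')
  refine (measure_mono hsub).trans ((measure_biUnion_finset_le _ _).trans ?_)
  have hinner : ∀ γ ∈ box, (Measure.pi fun _ : Fin n => D)
      (⋃ J ∈ Finset.powersetCard m (Finset.univ : Finset (Fin n)), {H | ∀ i ∈ J, H i ∈ s γ}) ≤
      (n ^ m : ℕ) * ENNReal.ofReal c ^ m := by
    intro γ _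
    refine (measure_biUnion_finset_le _ _).trans ?_
    have : ∀ J ∈ Finset.powersetCard m (Finset.univ : Finset (Fin n)),
        (Measure.pi fun _ : Fin n => D) {H | ∀ i ∈ J, H i ∈ s γ} ≤ ENNReal.ofReal c ^ m := by
      intro J hJ
      rw [pi_forall_mem_eq, (Finset.mem_powersetCard.1 hJ).2]
      exact pow_le_pow_left' (hs γ) m
    refine (Finset.sum_le_card_nsmul _ _ _ this).trans ?_
    rw [nsmul_eq_mul, Finset.card_powersetCard, Finset.card_univ, Fintype.card_fin]
    gcongr
    exact Nat.choose_le_pow n m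
  refine (Finset.sum_le_card_nsmul _ _ _ hinner).trans (le_of_eq ?_)
  rw [nsmul_eq_mul, hbox, Nat.cast_mul, mul_assoc]

/-- Outside an event of probability at most `2 / n`, the points are bounded and no slab is
crowded. -/
theorem measure_bad_le {c₁ c₂ : ℝ} {l : ℕ} (hd : 1 ≤ d) (hn : 1 ≤ n) (hc₁ : 0 < c₁) (hc₂ : 0 < c₂)
    (hconc : ∀ α : ℝ, 0 < α → D {x | (d : ℝ) * α < ‖f x‖} ≤ ENNReal.ofReal (c₁ / α))
    (hanti : ∀ α : ℝ, 0 < α → ∀ v : EuclideanSpace ℝ (Fin d), ‖v‖ = 1 → ∀ b : ℝ,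
      D {x | |inner ℝ (f x) v + b| ≤ α} ≤ ENNReal.ofReal (c₂ * α))
    (hl : 8 * (d : ℝ) ^ 2 * n ^ 2 * (1 + c₁) * (1 + c₂) ≤ 2 ^ l) :
    (Measure.pi fun _ : Fin n => D) {H | (∃ i, d * ((1 + c₁) * n ^ 2) < ‖f (H i)‖) ∨
      ¬ ThinSlabs (fun i => f (H i)) (1 / 2 ^ (2 * l)) (5 * d + 6)} ≤
      ENNReal.ofReal (2 / n) := by
  have hd0 : (1 : ℝ) ≤ d := by exact_mod_cast hd
  have hn0 : (1 : ℝ) ≤ n := by exact_mod_cast hn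
  set Q : ℝ := 2 ^ l with hQ
  set R : ℝ := d * ((1 + c₁) * n ^ 2) with hRdef
  have hd2 : (1 : ℝ) ≤ (d : ℝ) ^ 2 := one_le_pow₀ hd0
  have hn2 : (1 : ℝ) ≤ (n : ℝ) ^ 2 := one_le_pow₀ hn0
  have hRpos : 0 < R := by positivity
  have hRd : 8 * (R * d) ≤ Q := by
    refine le_trans ?_ hl
    have : 8 * (R * d) = 8 * (d : ℝ) ^ 2 * n ^ 2 * (1 + c₁) := by rw [hRdef]; ring
    rw [this]
    exact le_mul_of_one_le_right (by positivity) (by linarith)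
  have hQn : 8 * (n * (1 + c₂)) ≤ Q := by
    refine le_trans ?_ hl
    have h1 : (n : ℝ) ≤ (n : ℝ) ^ 2 := by nlinarith
    have h2 : (n : ℝ) ≤ (d : ℝ) ^ 2 * n ^ 2 * (1 + c₁) := by
      calc (n : ℝ) ≤ 1 * (n : ℝ) ^ 2 * 1 := by linarith
        _ ≤ (d : ℝ) ^ 2 * n ^ 2 * (1 + c₁) := by gcongr; linarith
    nlinarith [mul_le_mul_of_nonneg_right h2 (show 0 ≤ 1 + c₂ by linarith)]
  have hRd' : R ≤ R * d := le_mul_of_one_le_right hRpos.le hd0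
  have hQ8 : 8 ≤ Q := by nlinarith
  have hQ0 : 0 < Q := by linarith
  have hβ : (1 / 2 ^ (2 * l) : ℝ) = 1 / Q ^ 2 := by rw [hQ, mul_comm, pow_mul]
  rw [hβ]
  have hβ1 : 1 / Q ^ 2 ≤ 1 := by
    rw [div_le_one (by positivity)]; nlinarith
  have hAβ : ((2 ^ (4 * l) : ℕ) : ℝ) * (1 / Q ^ 2) = Q ^ 2 := by
    have : ((2 ^ (4 * l) : ℕ) : ℝ) = Q ^ 4 := by
      rw [hQ]; push_cast; rw [← pow_mul, mul_comm]
    rw [this]; field_simp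
  have hQQ : 8 * Q ≤ Q ^ 2 := by nlinarith
  have hthin := measure_not_thinSlabs_le (n := n) D f (R := R) (β := 1 / Q ^ 2) (A := 2 ^ (4 * l))
    (m := 5 * d + 6) (c := c₂ * (3 * (1 / Q ^ 2))) hd (by omega) hRpos (by positivity)
    (fun v hv t => hanti _ (by positivity) v hv t) (by rw [hAβ]; linarith)
    (by rw [hAβ]; linarith)
  have hnorm := measure_exists_norm_gt_le (n := n) D f (R := R)
    (hconc ((1 + c₁) * n ^ 2) (by positivity))
  have hsub : {H : Fin n → EuclideanSpace ℝ (Fin d) | (∃ i, R < ‖f (H i)‖) ∨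
      ¬ ThinSlabs (fun i => f (H i)) (1 / Q ^ 2) (5 * d + 6)} ⊆ {H | ∃ i, R < ‖f (H i)‖} ∪
      {H | (∀ i, ‖f (H i)‖ ≤ R) ∧ ¬ ThinSlabs (fun i => f (H i)) (1 / Q ^ 2) (5 * d + 6)} := by
    intro H hH
    by_cases h : ∃ i, R < ‖f (H i)‖
    · exact Or.inl h
    · refine Or.inr ⟨?_, hH.resolve_left h⟩
      push Not at h
      exact h
  refine (measure_mono hsub).trans ((measure_union_le _ _).trans ?_)
  have e1 : (n : ℝ≥0∞) * ENNReal.ofReal (c₁ / ((1 + c₁) * n ^ 2)) ≤ ENNReal.ofReal (1 / n) := by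
    rw [← ENNReal.ofReal_natCast, ← ENNReal.ofReal_mul (by positivity)]
    refine ENNReal.ofReal_le_ofReal ?_
    rw [mul_div_assoc', div_le_div_iff₀ (by positivity) (by positivity)]
    nlinarith
  -- With `β = Q^(-2)` and `A = Q^4` there are at most `Q^(5(d+1))` cells, and `n * 3c₂β ≤ 1/Q`.
  -- Since `5d + 6 = 5(d+1) + 1`, one factor `1/Q ≤ 1/n` is left over.
  have e2 : (((2 * 2 ^ (4 * l) + 1) ^ (d + 1) * n ^ (5 * d + 6) : ℕ) : ℝ≥0∞) *
      ENNReal.ofReal (c₂ * (3 * (1 / Q ^ 2))) ^ (5 * d + 6) ≤ ENNReal.ofReal (1 / n) := by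
    rw [← ENNReal.ofReal_natCast, ← ENNReal.ofReal_pow (by positivity),
      ← ENNReal.ofReal_mul (by positivity)]
    refine ENNReal.ofReal_le_ofReal ?_
    push_cast
    have h4 : (2 * 2 ^ (4 * l) + 1 : ℝ) ≤ Q ^ 5 := by
      have : (2 : ℝ) ^ (4 * l) = Q ^ 4 := by rw [hQ, ← pow_mul, mul_comm]
      rw [this]
      have h1 : (1 : ℝ) ≤ Q ^ 4 := one_le_pow₀ (by linarith)
      have h2 : Q ^ 5 = Q * Q ^ 4 := by ring
      rw [h2]
      nlinarith
    have h5 : n * (c₂ * (3 * (1 / Q ^ 2))) ≤ 1 / Q := by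
      rw [show n * (c₂ * (3 * (1 / Q ^ 2))) = (3 * (n * c₂)) / Q ^ 2 by ring,
        div_le_div_iff₀ (by positivity) hQ0]
      have : 3 * (n * c₂) ≤ Q := by nlinarith
      nlinarith
    calc (2 * 2 ^ (4 * l) + 1 : ℝ) ^ (d + 1) * n ^ (5 * d + 6) *
          (c₂ * (3 * (1 / Q ^ 2))) ^ (5 * d + 6)
        = (2 * 2 ^ (4 * l) + 1 : ℝ) ^ (d + 1) *
          (n * (c₂ * (3 * (1 / Q ^ 2)))) ^ (5 * d + 6) := by rw [mul_pow (n : ℝ)]; ring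
      _ ≤ (Q ^ 5) ^ (d + 1) * (1 / Q) ^ (5 * d + 6) := by gcongr
      _ = 1 / Q := by
          rw [← pow_mul, show 5 * d + 6 = 5 * (d + 1) + 1 by ring, pow_succ, ← mul_assoc,
            ← mul_pow, mul_one_div_cancel hQ0.ne', one_pow, one_mul]
      _ ≤ 1 / n := by
          refine one_div_le_one_div_of_le (by linarith) ?_
          nlinarith
  refine (add_le_add (hnorm.trans e1) (hthin.trans e2)).trans (le_of_eq ?_)
  rw [← ENNReal.ofReal_add (by positivity) (by positivity)]
  congr 1
  ring

end Probability

/-! ### Building the decision tree -/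

section Trees

variable {d n : ℕ} (b : ℝ) (H : Fin n → EuclideanSpace ℝ (Fin d))

/-- Starting from the knowledge `x ∈ X`, at most `m` adaptive queries lead to a set of consistent
points that satisfies `Φ`. -/
inductive ReachesWithin (Φ : Set (EuclideanSpace ℝ (Fin d)) → Prop) :
    ℕ → Set (EuclideanSpace ℝ (Fin d)) → Prop
  | done {m X} : Φ X → ReachesWithin Φ m X
  | ask {m X} (q : ArrangementQuery n) :
      (∀ a, ReachesWithin Φ m {x ∈ X | q.answer b H x = a}) → ReachesWithin Φ (m + 1) X

/-- All points of `X` give the same answer to the query `q`. -/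
def ConstantAnswer (X : Set (EuclideanSpace ℝ (Fin d))) (q : ArrangementQuery n) : Prop :=
  ∀ x ∈ X, ∀ y ∈ X, q.answer b H x = q.answer b H y

variable {b H} {Φ Ψ : Set (EuclideanSpace ℝ (Fin d)) → Prop}
  {X Y : Set (EuclideanSpace ℝ (Fin d))} {m m' : ℕ}

theorem ReachesWithin.mono_right (h : ReachesWithin b H Φ m X) (hm : m ≤ m') :
    ReachesWithin b H Φ m' X := by
  induction h generalizing m' with
  | done h => exact .done h
  | ask q _ ih =>
    cases m' with
    | zero => omega
    | succ k => exact .ask q fun a => ih a (Nat.le_of_succ_le_succ hm)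

theorem ReachesWithin.bind (h : ReachesWithin b H Φ m X)
    (hΦ : ∀ Y ⊆ X, Φ Y → ReachesWithin b H Ψ m' Y) : ReachesWithin b H Ψ (m + m') X := by
  induction h with
  | done h => exact (hΦ _ subset_rfl h).mono_right (by omega)
  | @ask m X q _ ih =>
    rw [add_right_comm]
    exact .ask q fun a => ih a fun Y hY => hΦ Y (hY.trans (Set.sep_subset _ _))

theorem ReachesWithin.imp (h : ReachesWithin b H Φ m X) (hΦ : ∀ Y ⊆ X, Φ Y → Ψ Y) :
    ReachesWithin b H Ψ m X :=
  h.bind (m' := 0) fun Y hY h => .done (hΦ Y hY h)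

theorem ReachesWithin.exists_tree
    (h : ReachesWithin b H (fun X => ∀ i, ConstantAnswer b H X (.label i)) m X) :
    ∃ T : ComparisonLDT n, T.depth ≤ m ∧ ∀ x ∈ X, T.eval b H x = cellOf b H x := by
  induction h with
  | @done m X h =>
    rcases X.eq_empty_or_nonempty with rfl | ⟨x₀, hx₀⟩
    · exact ⟨.leaf 0, by simp [ComparisonLDT.depth], by simp⟩
    · exact ⟨.leaf (cellOf b H x₀), by simp [ComparisonLDT.depth], fun x hx =>
        funext fun i => h i x₀ hx₀ x hx⟩
  | ask q _ ih =>
    choose T hT hT' using ih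
    refine ⟨.node q T, ?_, fun x hx => hT' (q.answer b H x) x ⟨hx, rfl⟩⟩
    simp only [ComparisonLDT.depth, add_le_add_iff_right]
    exact Finset.sup_le fun a _ => hT a

/-- Idle queries make the depth exact, so that its measurability does not depend on how the trees
are chosen. -/
theorem ComparisonLDT.exists_depth_eq [NeZero n] (T : ComparisonLDT n) (hT : T.depth ≤ m) :
    ∃ T' : ComparisonLDT n, T'.depth = m ∧ ∀ (b : ℝ) (H : Fin n → EuclideanSpace ℝ (Fin d)) x,
      T'.eval b H x = T.eval b H x := by
  induction m, hT using Nat.le_induction with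
  | base => exact ⟨T, rfl, fun _ _ _ => rfl⟩
  | succ m _ ih =>
    obtain ⟨T', h, h'⟩ := ih
    refine ⟨.node (.label 0) fun _ => T', ?_, fun b H x => h' b H x⟩
    simp [ComparisonLDT.depth, h, Finset.sup_const Finset.univ_nonempty]

theorem ConstantAnswer.anti {q : ArrangementQuery n} (h : ConstantAnswer b H X q) (hY : Y ⊆ X) :
    ConstantAnswer b H Y q := fun x hx y hy => h x (hY hx) y (hY hy)

theorem ConstantAnswer.comparison_symm {i j : Fin n}
    (h : ConstantAnswer b H X (.comparison i j)) : ConstantAnswer b H X (.comparison j i) := by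
  intro x hx y hy
  have := h x hx y hy
  simp only [ArrangementQuery.answer] at this ⊢
  rw [← neg_sub, Left.sign_neg, this, ← Left.sign_neg, neg_sub]

theorem constantAnswer_comparison_self (i : Fin n) :
    ConstantAnswer b H X (.comparison i i) := by
  intro x _ y _
  simp [ArrangementQuery.answer]

/-- Take the least value with at least half of `T` at or below it. The strict inequalities leave out
ties with `t`, which a comparison with `t` settles as well. -/
theorem exists_median {ι : Type*} (T : Finset ι) (hT : T.Nonempty) (v : ι → ℝ) {M : ℕ}
    (hM : T.card < 2 * M) :
    ∃ t ∈ T, (T.filter fun i => v i < v t).card < M ∧ (T.filter fun i => v t < v i).card < M := by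
  classical
  have hcompl : ∀ t, (T.filter fun i => v i ≤ v t).card + (T.filter fun i => v t < v i).card =
      T.card := by
    intro t
    rw [← Finset.card_filter_add_card_filter_not (s := T) fun i => v i ≤ v t]
    simp only [not_le]
  set F := T.filter fun t => T.card ≤ 2 * (T.filter fun i => v i ≤ v t).card with hF
  have hFne : F.Nonempty := by
    obtain ⟨t, ht, hmax⟩ := T.exists_max_image v hT
    refine ⟨t, Finset.mem_filter.2 ⟨ht, ?_⟩⟩
    rw [Finset.filter_true_of_mem hmax]
    omega
  obtain ⟨t, ht, hmin⟩ := F.exists_min_image v hFne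
  rw [hF, Finset.mem_filter] at ht
  refine ⟨t, ht.1, ?_, by have := hcompl t; omega⟩
  rcases (T.filter fun i => v i < v t).eq_empty_or_nonempty with h | h
  · rw [h, Finset.card_empty]; omega
  · obtain ⟨u, hu, humax⟩ := Finset.exists_max_image _ v h
    have hu' := Finset.mem_filter.1 hu
    have huF : u ∉ F := fun hmem => (hmin u hmem).not_gt hu'.2
    rw [hF, Finset.mem_filter, not_and, not_le] at huF
    have h1 := huF hu'.1
    have h2 : (T.filter fun i => v i < v t).card ≤ (T.filter fun i => v i ≤ v u).card :=
      Finset.card_le_card fun i hi =>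
        Finset.mem_filter.2 ⟨(Finset.mem_filter.1 hi).1, humax i hi⟩
    omega

/-- Binary search for the position of one value among sorted values. -/
theorem reachesWithin_insert (y : Fin n) (r : ℕ) (T : Finset (Fin n))
    (hT : ∀ i ∈ T, ∀ j ∈ T, ConstantAnswer b H X (.comparison i j)) (hr : T.card < 2 ^ r) :
    ReachesWithin b H (fun Z => ∀ i ∈ T, ConstantAnswer b H Z (.comparison y i)) r X := by
  classical
  induction r generalizing T X with
  | zero =>
    refine .done fun i hi => ?_
    simp only [pow_zero, Nat.lt_one_iff, Finset.card_eq_zero] at hr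
    simp [hr] at hi
  | succ r ih =>
    -- The order of `T` is the same at all points of `X`, so any `x₀ ∈ X` represents it.
    rcases X.eq_empty_or_nonempty with rfl | ⟨x₀, hx₀⟩
    · exact .done fun i _ x hx => hx.elim
    rcases T.eq_empty_or_nonempty with rfl | hne
    · exact .done fun i hi => by simp at hi
    obtain ⟨t, ht, hlow, hhigh⟩ := exists_median T hne (fun i => hyperplaneValue b (H i) x₀)
      (M := 2 ^ r) (by rw [pow_succ] at hr; omega)
    have hle : ∀ i ∈ T, hyperplaneValue b (H t) x₀ ≤ hyperplaneValue b (H i) x₀ → ∀ x ∈ X,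
        hyperplaneValue b (H t) x ≤ hyperplaneValue b (H i) x := by
      intro i hi h x hx
      have := hT i hi t ht x hx x₀ hx₀
      simp only [ArrangementQuery.answer] at this
      by_contra! hlt
      rw [sign_neg (by linarith), eq_comm, sign_eq_neg_one_iff] at this
      linarith
    have hge : ∀ i ∈ T, hyperplaneValue b (H i) x₀ ≤ hyperplaneValue b (H t) x₀ → ∀ x ∈ X,
        hyperplaneValue b (H i) x ≤ hyperplaneValue b (H t) x := by
      intro i hi h x hx
      have := hT i hi t ht x hx x₀ hx₀
      simp only [ArrangementQuery.answer] at this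
      by_contra! hlt
      rw [sign_pos (by linarith), eq_comm, sign_eq_one_iff] at this
      linarith
    refine .ask (.comparison y t) fun a => ?_
    have hsub : {x ∈ X | (ArrangementQuery.comparison y t).answer b H x = a} ⊆ X :=
      Set.sep_subset _ _
    cases a with
    | zero =>
      refine .done fun i hi x hx z hz => ?_
      have h1 := hT t ht i hi x hx.1 z hz.1
      have h2 := sign_eq_zero_iff.1 hx.2
      have h3 := sign_eq_zero_iff.1 hz.2
      simp only [ArrangementQuery.answer] at h1 ⊢
      rwa [sub_eq_zero.1 h2, sub_eq_zero.1 h3]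
    | neg =>
      refine (ih (T.filter fun i => hyperplaneValue b (H i) x₀ < hyperplaneValue b (H t) x₀)
        (fun i hi j hj => (hT i (Finset.mem_filter.1 hi).1 j (Finset.mem_filter.1 hj).1).anti hsub)
        hlow).imp fun Y hY hc i hi => ?_
      rcases lt_or_ge (hyperplaneValue b (H i) x₀) (hyperplaneValue b (H t) x₀) with h | h
      · exact hc i (Finset.mem_filter.2 ⟨hi, h⟩)
      · have key : ∀ x ∈ Y, (ArrangementQuery.comparison y i).answer b H x = -1 := by
          intro x hx
          have h1 := hle i hi h x (hY hx).1
          have h2 := sign_eq_neg_one_iff.1 (hY hx).2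
          exact sign_eq_neg_one_iff.2 (by linarith)
        intro x hx z hz
        rw [key x hx, key z hz]
    | pos =>
      refine (ih (T.filter fun i => hyperplaneValue b (H t) x₀ < hyperplaneValue b (H i) x₀)
        (fun i hi j hj => (hT i (Finset.mem_filter.1 hi).1 j (Finset.mem_filter.1 hj).1).anti hsub)
        hhigh).imp fun Y hY hc i hi => ?_
      rcases lt_or_ge (hyperplaneValue b (H t) x₀) (hyperplaneValue b (H i) x₀) with h | h
      · exact hc i (Finset.mem_filter.2 ⟨hi, h⟩)
      · have key : ∀ x ∈ Y, (ArrangementQuery.comparison y i).answer b H x = 1 := by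
          intro x hx
          have h1 := hge i hi h x (hY hx).1
          have h2 := sign_eq_one_iff.1 (hY hx).2
          exact sign_eq_one_iff.2 (by linarith)
        intro x hx z hz
        rw [key x hx, key z hz]

/-- Insertion sort with binary search: before each insertion the sorted set has fewer than `2 ^ r`
elements, so `r` comparisons suffice. -/
theorem reachesWithin_sort (r : ℕ) (S : Finset (Fin n)) (hS : S.card ≤ 2 ^ r) :
    ReachesWithin b H (fun Z => ∀ i ∈ S, ∀ j ∈ S, ConstantAnswer b H Z (.comparison i j))
      (S.card * r) X := by
  classical
  induction S using Finset.induction_on generalizing X with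
  | empty => exact .done (by simp)
  | insert y S hy ih =>
    rw [Finset.card_insert_of_notMem hy] at hS ⊢
    rw [add_mul, one_mul]
    refine (ih (by omega)).bind fun Y _ hY =>
      (reachesWithin_insert y r S hY (by omega)).imp fun Z hZ hZ' => ?_
    intro i hi j hj
    rcases Finset.mem_insert.1 hi with hi' | hi' <;>
      rcases Finset.mem_insert.1 hj with hj' | hj'
    · rw [hi', hj']
      exact constantAnswer_comparison_self _
    · rw [hi']
      exact hZ' j hj'
    · rw [hj']
      exact (hZ' i hi').comparison_symm
    · exact (hY i hi' j hj').anti hZ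

theorem reachesWithin_labels (S : Finset (Fin n)) :
    ReachesWithin b H (fun Z => ∀ i ∈ S, ConstantAnswer b H Z (.label i)) S.card X := by
  classical
  induction S using Finset.induction_on generalizing X with
  | empty => exact .done (by simp)
  | insert y S hy ih =>
    rw [Finset.card_insert_of_notMem hy]
    refine .ask (.label y) fun a => ih.imp fun Y hY hc i hi => ?_
    rcases Finset.mem_insert.1 hi with rfl | hi
    · exact fun x hx z hz => (hY hx).2.trans (hY hz).2.symm
    · exact hc i hi

variable (b H) in
open Classical in
/-- The indices whose labels at `x` are forced by the labels and comparisons within `S` at `x`. -/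
noncomputable def inferred (x : EuclideanSpace ℝ (Fin d)) (S : Finset (Fin n)) :
    Finset (Fin n) :=
  Finset.univ.filter fun i => ∀ z, (∀ j ∈ S, (ArrangementQuery.label j).answer b H z =
      (ArrangementQuery.label j).answer b H x) →
    (∀ j ∈ S, ∀ l ∈ S, (ArrangementQuery.comparison j l).answer b H z =
      (ArrangementQuery.comparison j l).answer b H x) →
    (ArrangementQuery.label i).answer b H z = (ArrangementQuery.label i).answer b H x

theorem mem_inferred {x : EuclideanSpace ℝ (Fin d)} {S : Finset (Fin n)} {i : Fin n} :
    i ∈ inferred b H x S ↔ ∀ z, (∀ j ∈ S, (ArrangementQuery.label j).answer b H z =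
      (ArrangementQuery.label j).answer b H x) →
    (∀ j ∈ S, ∀ l ∈ S, (ArrangementQuery.comparison j l).answer b H z =
      (ArrangementQuery.comparison j l).answer b H x) →
    (ArrangementQuery.label i).answer b H z = (ArrangementQuery.label i).answer b H x := by
  simp [inferred]

theorem inferred_mono (x : EuclideanSpace ℝ (Fin d)) : Monotone (inferred b H x) := by
  intro S T hST i hi
  rw [mem_inferred] at hi ⊢
  exact fun z h1 h2 => hi z (fun j hj => h1 j (hST hj)) fun j hj l hl => h2 j (hST hj) l (hST hl)

theorem subset_inferred (x : EuclideanSpace ℝ (Fin d)) (S : Finset (Fin n)) :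
    S ⊆ inferred b H x S := by
  intro i hi
  rw [mem_inferred]
  exact fun z h1 _ => h1 i hi

theorem inferred_congr {x y : EuclideanSpace ℝ (Fin d)}
    (h : ∀ q : ArrangementQuery n, q.answer b H y = q.answer b H x) (S : Finset (Fin n)) :
    inferred b H y S = inferred b H x S := by
  ext i
  simp only [mem_inferred, h]

variable {k : ℕ}

/-- `inferred` depends on `x` only through its answers, so the union bound over representatives
covers all points. The sample is fixed before anything is known about `x`, as a deterministic tree
requires. -/
theorem exists_halving_sample
    (hk : ∀ (x : EuclideanSpace ℝ (Fin d)) (S : Finset (Fin n)), k ≤ S.card →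
      ∃ i ∈ S, i ∈ inferred b H x (S.erase i))
    (hcount : (2 * (n + n * n) + 1) ^ (d + 1) < 2 ^ (12 * k))
    (U : Finset (Fin n)) (hU : 64 * k ≤ U.card) :
    ∃ S ⊆ U, S.card = 64 * k ∧ ∀ x, 2 * (U \ inferred b H x S).card ≤ U.card := by
  obtain ⟨reps, hcard, hreps⟩ := exists_representatives b H
  obtain ⟨S, hSU, hS, h⟩ := exists_sample reps (inferred b H) inferred_mono subset_inferred hk U hU
    (hcard.trans_lt hcount)
  refine ⟨S, hSU, hS, fun x => ?_⟩
  obtain ⟨y, hy, hyx⟩ := hreps x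
  rw [← inferred_congr hyx]
  exact h y hy

/-- A round asks `64k` labels and at most `64k * ρ` comparisons, and at least halves the set of open
labels. Once fewer than `64k` are open, they are queried directly. -/
theorem reachesWithin_halving
    (hk : ∀ (x : EuclideanSpace ℝ (Fin d)) (S : Finset (Fin n)), k ≤ S.card →
      ∃ i ∈ S, i ∈ inferred b H x (S.erase i))
    (hcount : (2 * (n + n * n) + 1) ^ (d + 1) < 2 ^ (12 * k))
    {ρ : ℕ} (hρ : 64 * k ≤ 2 ^ ρ) (r : ℕ) (U : Finset (Fin n))
    (hX : ∀ i ∉ U, ConstantAnswer b H X (.label i)) (hU : U.card < 64 * k * 2 ^ r) :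
    ReachesWithin b H (fun X => ∀ i, ConstantAnswer b H X (.label i))
      (r * (64 * k * (ρ + 1)) + 64 * k) X := by
  classical
  induction r generalizing U X with
  | zero =>
    refine ((reachesWithin_labels U).imp fun Y hY h i => ?_).mono_right
      (m := U.card) (by omega)
    by_cases hi : i ∈ U
    · exact h i hi
    · exact (hX i hi).anti hY
  | succ r ih =>
    rcases lt_or_ge U.card (64 * k) with hlt | hge
    · exact (ih U hX (hlt.trans_le (Nat.le_mul_of_pos_right _ (by positivity)))).mono_right
        (by gcongr; omega)
    obtain ⟨S, hSU, hS, hhalf⟩ := exists_halving_sample hk hcount U hge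
    rw [show (r + 1) * (64 * k * (ρ + 1)) + 64 * k =
      64 * k + (64 * k * ρ + (r * (64 * k * (ρ + 1)) + 64 * k)) by ring]
    rw [← hS] at hρ
    have h1 := reachesWithin_labels (b := b) (H := H) (X := X) S
    have h2 : ∀ Y, ReachesWithin b H _ (S.card * ρ) Y := fun Y =>
      reachesWithin_sort (X := Y) ρ S hρ
    rw [hS] at h1 h2
    refine h1.bind fun Y hY hlab => (h2 Y).bind fun Z hZ hcmp => ?_
    rcases Z.eq_empty_or_nonempty with rfl | ⟨x₀, hx₀⟩
    · exact .done fun i x hx => hx.elim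
    refine ih (U \ inferred b H x₀ S) (fun i hi => ?_) ?_
    · by_cases hiU : i ∈ U
      · have hinf : i ∈ inferred b H x₀ S := by
          by_contra hcon
          exact hi (Finset.mem_sdiff.2 ⟨hiU, hcon⟩)
        rw [mem_inferred] at hinf
        have key : ∀ x ∈ Z, _ := fun x hx => hinf x
          (fun j hj => hlab j hj x (hZ hx) x₀ (hZ hx₀)) fun j hj l hl => hcmp j hj l hl x hx x₀ hx₀
        exact fun x hx z hz => (key x hx).trans (key z hz).symm
      · exact (hX i hiU).anti (hZ.trans hY)
    · have := hhalf x₀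
      rw [pow_succ, ← mul_assoc] at hU
      omega

theorem exists_tree_of_inferred
    (hk : ∀ (x : EuclideanSpace ℝ (Fin d)) (S : Finset (Fin n)), k ≤ S.card →
      ∃ i ∈ S, i ∈ inferred b H x (S.erase i))
    (hcount : (2 * (n + n * n) + 1) ^ (d + 1) < 2 ^ (12 * k))
    {ρ r : ℕ} (hρ : 64 * k ≤ 2 ^ ρ) (hr : n < 64 * k * 2 ^ r) :
    ∃ T : ComparisonLDT n, T.depth ≤ r * (64 * k * (ρ + 1)) + 64 * k ∧
      T.SolvesPointLocation b H := by
  obtain ⟨T, hT, h⟩ := (reachesWithin_halving (X := Set.univ) hk hcount hρ r Finset.univ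
    (by simp) (by simpa using hr)).exists_tree
  exact ⟨T, hT, fun x => h x trivial⟩

theorem exists_tree_depth_le (b : ℝ) (H : Fin n → EuclideanSpace ℝ (Fin d)) :
    ∃ T : ComparisonLDT n, T.depth ≤ n ∧ T.SolvesPointLocation b H := by
  obtain ⟨T, hT, h⟩ := ((reachesWithin_labels (b := b) (H := H) (X := Set.univ)
    Finset.univ).imp fun Y _ h i => h i (Finset.mem_univ i)).exists_tree
  exact ⟨T, by simpa using hT, fun x => h x trivial⟩

end Trees

/-! ### From thin slabs to trees of small expected depth -/

/-- Duality: the value is affine in `h`, hence in `f h`, and `w` is the image of `x` under the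
adjoint of the linear part of `f.symm`. Inference for all `(w, t)` in normalized coordinates thus
covers all inputs. -/
theorem exists_inner_add_eq_hyperplaneValue {d : ℕ}
    (f : EuclideanSpace ℝ (Fin d) ≃ᵃ[ℝ] EuclideanSpace ℝ (Fin d)) (b : ℝ)
    (x : EuclideanSpace ℝ (Fin d)) :
    ∃ (w : EuclideanSpace ℝ (Fin d)) (t : ℝ), ∀ h, hyperplaneValue b h x = inner ℝ (f h) w + t := by
  let A : EuclideanSpace ℝ (Fin d) →ₗ[ℝ] EuclideanSpace ℝ (Fin d) :=
    (f.symm : EuclideanSpace ℝ (Fin d) →ᵃ[ℝ] EuclideanSpace ℝ (Fin d)).linear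
  refine ⟨LinearMap.adjoint A x, inner ℝ (f.symm 0) x + b, fun h => ?_⟩
  have h1 : h = A (f h) + f.symm 0 := by
    conv_lhs => rw [← f.symm_apply_apply h]
    exact congrFun
      (f.symm : EuclideanSpace ℝ (Fin d) →ᵃ[ℝ] EuclideanSpace ℝ (Fin d)).decomp (f h)
  rw [LinearMap.adjoint_inner_right, hyperplaneValue]
  conv_lhs => rw [h1]
  rw [inner_add_left, add_assoc]

/-- The parameters are `β = 2^(-2l)`, `A = 2^(5l)`, `m = 5d + 6` and `q = 6ld + 1`. Then `2A + 1 ≤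
2^(6l)` gives the pigeonhole condition, and `k = 3m + 2q + 1 = 12ld + 15d + 21`. -/
theorem exists_tree_of_thinSlabs {d n l ρ r : ℕ} (hd : 1 ≤ d) (hn : 1 ≤ n) {R : ℝ} (hR0 : 0 ≤ R)
    (f : EuclideanSpace ℝ (Fin d) ≃ᵃ[ℝ] EuclideanSpace ℝ (Fin d)) (b : ℝ)
    (H : Fin n → EuclideanSpace ℝ (Fin d)) (hR : ∀ i, ‖f (H i)‖ ≤ R)
    (hthin : ThinSlabs (fun i => f (H i)) (1 / 2 ^ (2 * l)) (5 * d + 6))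
    (hRl : 2 * R * d ≤ 2 ^ l) (hdl : 8 * d ≤ 2 ^ l) (hnl : 8 * n ^ 2 ≤ 2 ^ l)
    (hρ : 64 * (12 * l * d + 15 * d + 21) ≤ 2 ^ ρ) (hr : n < 2 ^ r) :
    ∃ T : ComparisonLDT n,
      T.depth ≤ r * (64 * (12 * l * d + 15 * d + 21) * (ρ + 1)) +
        64 * (12 * l * d + 15 * d + 21) ∧ T.SolvesPointLocation b H := by
  have hl : 3 ≤ l := by
    by_contra! h
    have : 2 ^ l ≤ 2 ^ 2 := Nat.pow_le_pow_right (by norm_num) (by omega)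
    omega
  have hA : ((6 * l * d + 1 : ℕ) : ℝ) * (2 * R) * d ≤
      ((2 ^ (5 * l) : ℕ) : ℝ) * (1 / 2 ^ (2 * l)) := by
    have h1 : ((6 * l * d + 1 : ℕ) : ℝ) ≤ 2 ^ (2 * l) := by
      have hlt : l + 1 ≤ 2 ^ l := Nat.lt_two_pow_self
      have : 6 * l * d + 1 ≤ 2 ^ (2 * l) := by
        rw [two_mul, pow_add]
        nlinarith
      exact_mod_cast this
    have h2 : ((2 ^ (5 * l) : ℕ) : ℝ) * (1 / 2 ^ (2 * l)) = 2 ^ (2 * l) * 2 ^ l := by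
      push_cast
      rw [mul_one_div, div_eq_iff (by positivity), ← pow_add, ← pow_add]
      congr 1
      ring
    rw [h2, mul_assoc]
    exact mul_le_mul h1 hRl (by positivity) (by positivity)
  have hcard : (2 * 2 ^ (5 * l) + 1) ^ d < 2 ^ (6 * l * d + 1) := by
    calc (2 * 2 ^ (5 * l) + 1) ^ d ≤ (2 ^ (6 * l)) ^ d := by
          refine Nat.pow_le_pow_left ?_ d
          rw [show 6 * l = 5 * l + l by ring, pow_add]
          have : 1 ≤ 2 ^ (5 * l) := Nat.one_le_two_pow
          nlinarith
      _ = 2 ^ (6 * l * d) := (pow_mul _ _ _).symm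
      _ < 2 ^ (6 * l * d + 1) := Nat.pow_lt_pow_right (by norm_num) (by omega)
  refine exists_tree_of_inferred (fun x S hS => ?_) ?_ hρ
    (hr.trans_le (Nat.le_mul_of_pos_left _ (by omega)))
  · obtain ⟨w₀, t₀, h₀⟩ := exists_inner_add_eq_hyperplaneValue f b x
    obtain ⟨i, hi, h⟩ := exists_inferred (q := 6 * l * d + 1) (A := 2 ^ (5 * l)) hd hR0 hR
      (by positivity) (by omega) hthin hA hcard (fun i => hyperplaneValue b (H i) x) S
      (by linarith)
    refine ⟨i, hi, mem_inferred.2 fun z hlab hcmp => ?_⟩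
    obtain ⟨w, t, hz⟩ := exists_inner_add_eq_hyperplaneValue f b z
    simp only [ArrangementQuery.answer, hz] at hlab hcmp ⊢
    exact h w t hlab hcmp
  · calc (2 * (n + n * n) + 1) ^ (d + 1) ≤ (2 ^ l) ^ (d + 1) := by
          refine Nat.pow_le_pow_left ?_ _
          nlinarith
      _ = 2 ^ (l * (d + 1)) := (pow_mul _ _ _).symm
      _ < 2 ^ (12 * (12 * l * d + 15 * d + 21)) :=
          Nat.pow_lt_pow_right (by norm_num) (by nlinarith)

/-- `bad` need not be measurable, so it is replaced by a measurable hull of the same measure. Padded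
trees have depth exactly `n` on the hull and `m` off it. -/
theorem exists_integrable_trees {d n : ℕ} [NeZero n]
    (μ : Measure (Fin n → EuclideanSpace ℝ (Fin d))) [IsProbabilityMeasure μ] (b : ℝ) (m : ℕ)
    (bad : Set (Fin n → EuclideanSpace ℝ (Fin d)))
    (h : ∀ H ∉ bad, ∃ T : ComparisonLDT n, T.depth ≤ m ∧ T.SolvesPointLocation b H) :
    ∃ T : (Fin n → EuclideanSpace ℝ (Fin d)) → ComparisonLDT n,
      (∀ H, (T H).SolvesPointLocation b H) ∧ Measurable (fun H => (T H).depth) ∧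
      ∫⁻ H, ((T H).depth : ℝ≥0∞) ∂μ ≤ m + n * μ bad := by
  classical
  set B := toMeasurable μ bad
  have hB : MeasurableSet B := measurableSet_toMeasurable _ _
  have key : ∀ H, ∃ T : ComparisonLDT n, T.SolvesPointLocation b H ∧
      T.depth = if H ∈ B then n else m := by
    intro H
    have : ∃ T : ComparisonLDT n, T.depth ≤ (if H ∈ B then n else m) ∧
        T.SolvesPointLocation b H := by
      split_ifs with hH
      · exact exists_tree_depth_le b H
      · exact h H fun hb => hH (subset_toMeasurable _ _ hb)
    obtain ⟨T, hT, hT'⟩ := this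
    obtain ⟨T', h1, h2⟩ := T.exists_depth_eq (d := d) hT
    exact ⟨T', fun x => (h2 b H x).trans (hT' x), h1⟩
  choose T hT hT' using key
  refine ⟨T, hT, ?_, ?_⟩
  · simp only [hT']
    exact Measurable.ite hB measurable_const measurable_const
  · calc ∫⁻ H, ((T H).depth : ℝ≥0∞) ∂μ
        ≤ ∫⁻ H, ((m : ℝ≥0∞) + B.indicator (fun _ => (n : ℝ≥0∞)) H) ∂μ := by
          refine lintegral_mono fun H => ?_
          simp only [hT', Set.indicator]
          split_ifs <;> simp
      _ = m + n * μ bad := by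
          rw [lintegral_add_left measurable_const, lintegral_const, measure_univ, mul_one,
            lintegral_indicator_const hB, measure_toMeasurable]

/-! ### Numerical bounds on the depth -/

theorem log_98304_le : Real.log 98304 ≤ 12 := by
  rw [Real.log_le_iff_le_exp (by norm_num)]
  have h : Real.exp 12 = Real.exp 1 ^ 12 := by rw [← Real.exp_nat_mul]; norm_num
  rw [h]
  calc (98304 : ℝ) ≤ 2.7182818283 ^ 12 := by norm_num
    _ ≤ Real.exp 1 ^ 12 := by gcongr; exact Real.exp_one_gt_d9.le

theorem one_le_log_of_three_le {x : ℝ} (hx : 3 ≤ x) : 1 ≤ Real.log x := by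
  rw [Real.le_log_iff_exp_le (by linarith)]
  linarith [Real.exp_one_lt_d9]

/-- The cost of sorting `O(d (log n + L))` values, per dimension. -/
theorem sort_cost_le {d n a L G : ℝ} (hd : 1 ≤ d) (hL : 0.69 ≤ L) (ha : a = Real.log n)
    (hG : G = Real.log (d * a)) (ha3 : 3 ≤ a) (hLn : L ≤ n) (hdn : d ≤ n) :
    (a + L) * Real.log (49152 * (d * (a + L))) ≤ 39 * (L * a * G) := by
  have hn0 : 0 < n := by linarith
  have han : a ≤ n := ha ▸ Real.log_le_self hn0.le
  have hda : 3 ≤ d * a := by nlinarith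
  have hG1 : 1 ≤ G := hG ▸ one_le_log_of_three_le hda
  have hM0 : 0 < 49152 * (d * (a + L)) := by
    have : 0 < a + L := by linarith
    positivity
  have h12 := log_98304_le
  -- If `L ≤ a`, the logarithm is `O(G)` and `a + L = O(L * a)` since `L` is bounded below. If `a ≤
  -- L`, the logarithm may exceed `G`, but `d, a, L ≤ n` makes it `O(a)`, and `a + L ≤ 2 * L`.
  rcases le_total L a with hLa | hLa
  · have h1 : Real.log (49152 * (d * (a + L))) ≤ 13 * G := by
      have h : 49152 * (d * (a + L)) ≤ 98304 * (d * a) := by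
        have : d * (a + L) ≤ d * (a + a) := by gcongr
        linarith
      refine (Real.log_le_log hM0 h).trans ?_
      rw [Real.log_mul (by norm_num) (by linarith), ← hG]
      linarith
    have h2 : a + L ≤ 3 * (L * a) := by nlinarith
    calc (a + L) * Real.log (49152 * (d * (a + L))) ≤ 3 * (L * a) * (13 * G) :=
          mul_le_mul_of_nonneg h2 h1 (by linarith) (by linarith)
      _ = 39 * (L * a * G) := by ring
  · have h1 : Real.log (49152 * (d * (a + L))) ≤ 6 * a := by
      have h : 49152 * (d * (a + L)) ≤ 98304 * (n * n) := by
        have : d * (a + L) ≤ n * (n + n) := by gcongr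
        linarith
      refine (Real.log_le_log hM0 h).trans ?_
      rw [Real.log_mul (by norm_num) (by positivity), Real.log_mul hn0.ne' hn0.ne', ← ha]
      linarith
    have hLa0 : 0 ≤ L * a := by nlinarith
    have h3 : L * a ≤ L * a * G := le_mul_of_one_le_right hLa0 hG1
    calc (a + L) * Real.log (49152 * (d * (a + L))) ≤ (2 * L) * (6 * a) :=
          mul_le_mul_of_nonneg (by linarith) h1 (by linarith) (by linarith)
      _ ≤ 39 * (L * a * G) := by linarith

theorem ceil_logb_bounds {Q a L : ℝ} (hQ : 8 ≤ Q) (ha3 : 3 ≤ a) (hL : 0.69 ≤ L)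
    (hQL : Real.log Q ≤ 3 * Real.log 2 + 4 * a + 2 * L) :
    (3 : ℝ) ≤ ⌈Real.logb 2 Q⌉₊ ∧ (⌈Real.logb 2 Q⌉₊ : ℝ) ≤ 8 * (a + L) := by
  have hlog2 := Real.log_two_gt_d9
  have hlog2' := Real.log_two_lt_d9
  constructor
  · have h1 : Real.logb 2 8 ≤ Real.logb 2 Q :=
      Real.logb_le_logb_of_le (by norm_num) (by norm_num) hQ
    have h2 : Real.logb 2 8 = 3 := by
      rw [show (8 : ℝ) = 2 ^ (3 : ℕ) by norm_num, Real.logb_pow,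
        Real.logb_self_eq_one (by norm_num)]
      norm_num
    exact (h2 ▸ h1).trans (Nat.le_ceil _)
  · have h1 : 0 ≤ Real.logb 2 Q := Real.logb_nonneg (by norm_num) (by linarith)
    refine (Nat.ceil_lt_add_one h1).le.trans ?_
    rw [Real.logb, ← le_sub_iff_add_le, div_le_iff₀ (by linarith)]
    nlinarith

theorem log_add_one_le {n : ℕ} (hn : n ≠ 0) (ha3 : 3 ≤ Real.log n) :
    ((Nat.log 2 n + 1 : ℕ) : ℝ) ≤ 2 * Real.log n := by
  have h1 : ((2 : ℝ)) ^ Nat.log 2 n ≤ n := by exact_mod_cast Nat.pow_log_le_self 2 hn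
  have h2 := Real.log_le_log (by positivity) h1
  rw [Real.log_pow] at h2
  have h3 : (0 : ℝ) ≤ Nat.log 2 n := Nat.cast_nonneg _
  push_cast
  nlinarith [Real.log_two_gt_d9]

theorem clog_add_one_le {s : ℕ} {M : ℝ} (hs : 1 < s) (hsM : (s : ℝ) ≤ M) :
    (Nat.clog 2 s : ℝ) + 1 ≤ 2 * Real.log (4 * M) := by
  have h1 : 2 ^ (Nat.clog 2 s - 1) < s := Nat.pow_pred_clog_lt_self (by norm_num) hs
  obtain ⟨ρ, hρ⟩ := Nat.exists_eq_succ_of_ne_zero (Nat.clog_pos (b := 2) (by norm_num) hs).ne'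
  rw [hρ, Nat.succ_sub_one] at h1
  have h2 : (2 : ℝ) ^ (ρ + 2) ≤ 4 * M := by
    have : ((2 : ℝ) ^ ρ) ≤ s := by exact_mod_cast h1.le
    rw [pow_add]
    linarith
  have h3 := Real.log_le_log (by positivity) h2
  rw [Real.log_pow] at h3
  rw [hρ]
  push_cast at h3 ⊢
  have : (0 : ℝ) ≤ ρ := Nat.cast_nonneg _
  nlinarith [Real.log_two_gt_d9]

theorem total_cost_le {d n a L G D r s ρ : ℝ} (hd : 1 ≤ d) (hL : 0.69 ≤ L)
    (ha : a = Real.log n) (hG : G = Real.log (d * a)) (ha3 : 3 ≤ a) (hLn : L ≤ n) (hdn : d ≤ n)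
    (hD : 0.69 ≤ D) (hs0 : 0 ≤ s) (hρ0 : 0 ≤ ρ) (hr : r ≤ 2 * a)
    (hs : s ≤ 12288 * (d * (a + L)))
    (hρ : ρ + 1 ≤ 2 * Real.log (4 * (12288 * (d * (a + L))))) :
    r * (s * (ρ + 1)) + s + 2 ≤ 5000000 * L * (d * D * G * a ^ 2) := by
  have hkey := sort_cost_le hd hL ha hG ha3 hLn hdn
  have hda : 3 ≤ d * a := by nlinarith
  have hG1 : 1 ≤ G := hG ▸ one_le_log_of_three_le hda
  rw [← mul_assoc, show (4 : ℝ) * 12288 = 49152 by norm_num] at hρ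
  have haL : a + L ≤ d * (a + L) := le_mul_of_one_le_left (by linarith) hd
  have hlog : 1 ≤ Real.log (49152 * (d * (a + L))) := one_le_log_of_three_le (by linarith)
  obtain ⟨ν, hν⟩ : ∃ ν, ν = Real.log (49152 * (d * (a + L))) := ⟨_, rfl⟩
  rw [← hν] at hkey hρ hlog
  obtain ⟨M, hM⟩ : ∃ M, M = 12288 * (d * (a + L)) := ⟨_, rfl⟩
  have hM2 : 2 ≤ M := by linarith
  rw [← hM] at hs
  have h1 : r * (s * (ρ + 1)) ≤ 2 * a * (M * (2 * ν)) := by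
    have h2 : s * (ρ + 1) ≤ M * (2 * ν) := mul_le_mul hs hρ (by linarith) (by linarith)
    exact mul_le_mul hr h2 (by positivity) (by linarith)
  have haν : 1 ≤ a * ν := by nlinarith
  have hMν : M ≤ M * (a * ν) := le_mul_of_one_le_right (by linarith) haν
  have h3 : r * (s * (ρ + 1)) + s + 2 ≤ 73728 * (a * d) * ((a + L) * ν) := by
    have h4 : 73728 * (a * d) * ((a + L) * ν) = 6 * (M * (a * ν)) := by rw [hM]; ring
    rw [h4]
    linarith
  have h5 : 73728 * (a * d) * ((a + L) * ν) ≤ 73728 * (a * d) * (39 * (L * a * G)) :=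
    mul_le_mul_of_nonneg_left hkey (by positivity)
  have h6 : 0 ≤ L * d * G * a ^ 2 := by positivity
  -- The cost is bounded without `D`; the factor is inserted at the end through `D ≥ 0.69`.
  calc r * (s * (ρ + 1)) + s + 2 ≤ 73728 * (a * d) * (39 * (L * a * G)) := h3.trans h5
    _ = 2875392 * (L * d * G * a ^ 2) := by ring
    _ ≤ (5000000 * D) * (L * d * G * a ^ 2) := mul_le_mul_of_nonneg_right (by linarith) h6
    _ = _ := by ring

theorem depth_numerics {d n : ℕ} {L Q : ℝ} (hd : 1 ≤ d) (hL : Real.log 2 ≤ L)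
    (hn : 5000000 * L * (d * Real.log (d + 1) ^ 2) ≤ n)
    (hQ : 8 ≤ Q) (hQL : Real.log Q ≤ 3 * Real.log 2 + 4 * Real.log n + 2 * L)
    {l s : ℕ} (hl : l = ⌈Real.logb 2 Q⌉₊) (hs : s = 64 * (12 * l * d + 15 * d + 21)) :
    (((Nat.log 2 n + 1) * (s * (Nat.clog 2 s + 1)) + s : ℕ) : ℝ) + 2 ≤
      5000000 * L * (d * Real.log (d + 1) * Real.log (d * Real.log n) * Real.log n ^ 2) := by
  have hlog2 := Real.log_two_gt_d9
  have hd0 : (1 : ℝ) ≤ d := by exact_mod_cast hd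
  have hL0 : 0.69 ≤ L := by linarith
  have hld : 0.69 ≤ Real.log (d + 1) := by
    have := Real.log_le_log (by norm_num) (show (2 : ℝ) ≤ d + 1 by linarith)
    linarith
  have hld2 : 0.47 ≤ Real.log (d + 1) ^ 2 := by nlinarith
  have hnd' : 100 * (L * d) ≤ n := by
    refine le_trans ?_ hn
    have : 0 ≤ L * d := by positivity
    nlinarith
  have hnL : L ≤ n := by nlinarith
  have hnd : (d : ℝ) ≤ n := by nlinarith
  have hn60 : (60 : ℝ) ≤ n := by nlinarith
  have ha3 : 3 ≤ Real.log n := by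
    rw [Real.le_log_iff_exp_le (by linarith)]
    have h : Real.exp 3 = Real.exp 1 ^ 3 := by rw [← Real.exp_nat_mul]; norm_num
    rw [h]
    calc Real.exp 1 ^ 3 ≤ 3 ^ 3 := by gcongr; linarith [Real.exp_one_lt_d9]
      _ ≤ (n : ℝ) := by linarith
  have hn0 : n ≠ 0 := by
    rintro rfl
    norm_num at hn60
  obtain ⟨hl3, hl8⟩ := ceil_logb_bounds hQ ha3 hL0 hQL
  rw [← hl] at hl3 hl8
  -- Since `l ≥ 3` and `d ≥ 1`, `15d + 21 ≤ 12ld`; hence `s ≤ 1536ld`, and `l ≤ 8(log n + L)` gives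
  -- `12288`.
  have hs1 : (s : ℝ) ≤ 12288 * (d * (Real.log n + L)) := by
    rw [hs]
    push_cast
    have h1 : (d : ℝ) * 3 ≤ d * l := by gcongr
    have h2 : (d : ℝ) * l ≤ d * (8 * (Real.log n + L)) := by gcongr
    linarith
  have hs2 : 1 < s := by omega
  clear hs
  have hρ := clog_add_one_le hs2 hs1
  have hr := log_add_one_le hn0 ha3
  rw [Nat.cast_add, Nat.cast_mul, Nat.cast_mul, Nat.cast_add (Nat.clog 2 s), Nat.cast_one]
  exact total_cost_le hd0 hL0 rfl rfl ha3 hnL hnd hld (Nat.cast_nonneg _) (Nat.cast_nonneg _) hr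
    hs1 hρ

/-! ### The main theorem -/

theorem mainTheorem4 :
    ∃ C : ℝ, 0 < C ∧
      ∀ (d : ℕ), 1 ≤ d →
      ∀ (c₁ c₂ : ℝ), 0 < c₁ → 0 < c₂ →
      ∀ (D : Measure (EuclideanSpace ℝ (Fin d))) [IsProbabilityMeasure D],
        WeaklyNice D c₁ c₂ →
      ∀ (b : ℝ) (n : ℕ),
        C * Real.log (2 + c₁ + c₂) * (d * Real.log (d + 1) ^ 2) ≤ n →
        ∃ T : (Fin n → EuclideanSpace ℝ (Fin d)) → ComparisonLDT n,
          (∀ H, (T H).SolvesPointLocation b H) ∧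
          Measurable (fun H => (T H).depth) ∧
          ∫⁻ H, ((T H).depth : ℝ≥0∞) ∂(Measure.pi fun _ : Fin n => D) ≤
            ENNReal.ofReal (C * Real.log (2 + c₁ + c₂) *
              (d * Real.log (d + 1) * Real.log (d * Real.log n) * Real.log n ^ 2)) := by
  refine ⟨5000000, by norm_num, ?_⟩
  intro d hd c₁ c₂ hc₁ hc₂ D _ hD b n hn
  obtain ⟨D', ⟨f, hf⟩, hconc, hanti⟩ := hD
  have hlog2 := Real.log_two_gt_d9
  have hlog2' := Real.log_two_lt_d9
  have hd0 : (1 : ℝ) ≤ d := by exact_mod_cast hd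
  set L := Real.log (2 + c₁ + c₂) with hLdef
  have hL : Real.log 2 ≤ L := Real.log_le_log (by norm_num) (by linarith)
  have hnd : (d : ℝ) ≤ n := by
    have h1 : 0.69 ≤ Real.log (d + 1) := by
      have := Real.log_le_log (by norm_num) (show (2 : ℝ) ≤ d + 1 by linarith)
      linarith
    have h2 : 0.47 ≤ Real.log (d + 1) ^ 2 := by nlinarith
    refine le_trans ?_ hn
    have h3 : (d : ℝ) * 0.47 ≤ d * Real.log (d + 1) ^ 2 := by gcongr
    have h4 : (3450000 : ℝ) ≤ 5000000 * L := by linarith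
    nlinarith
  have hn0 : (1 : ℝ) ≤ n := hd0.trans hnd
  have hn1 : 1 ≤ n := by exact_mod_cast hn0
  have : NeZero n := ⟨by omega⟩
  have hfm : Measurable f :=
    (AffineMap.continuous_of_finiteDimensional
      (f : EuclideanSpace ℝ (Fin d) →ᵃ[ℝ] EuclideanSpace ℝ (Fin d))).measurable
  -- A single scale that dominates `2Rd`, `8d` and `8n²` and serves the probability bound, while
  -- `log Q = O(log n + L)` because `d ≤ n`.
  set Q : ℝ := 8 * (d : ℝ) ^ 2 * n ^ 2 * (1 + c₁) * (1 + c₂) with hQdef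
  have hd2 : (d : ℝ) ≤ (d : ℝ) ^ 2 := by nlinarith
  have hd2' : (1 : ℝ) ≤ (d : ℝ) ^ 2 := by linarith
  have hn2' : (1 : ℝ) ≤ (n : ℝ) ^ 2 := by nlinarith
  have hQpos : 0 < Q := by positivity
  have hQd : 8 * (d : ℝ) ≤ Q := by
    calc 8 * (d : ℝ) = 8 * d * 1 * 1 * 1 := by ring
      _ ≤ Q := by rw [hQdef]; gcongr <;> linarith
  have hQn : 8 * (n : ℝ) ^ 2 ≤ Q := by
    calc 8 * (n : ℝ) ^ 2 = 8 * 1 * n ^ 2 * 1 * 1 := by ring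
      _ ≤ Q := by rw [hQdef]; gcongr <;> linarith
  have hQR : 2 * (d * ((1 + c₁) * n ^ 2)) * (d : ℝ) ≤ Q := by
    calc 2 * (d * ((1 + c₁) * n ^ 2)) * (d : ℝ) = 2 * d ^ 2 * n ^ 2 * (1 + c₁) * 1 := by ring
      _ ≤ Q := by rw [hQdef]; gcongr <;> linarith
  have hQL : Real.log Q ≤ 3 * Real.log 2 + 4 * Real.log n + 2 * L := by
    have h1 : Q = 2 ^ 3 * (d : ℝ) ^ 2 * n ^ 2 * (1 + c₁) * (1 + c₂) := by rw [hQdef]; norm_num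
    rw [h1, Real.log_mul (by positivity) (by positivity),
      Real.log_mul (by positivity) (by positivity), Real.log_mul (by positivity) (by positivity),
      Real.log_mul (by positivity) (by positivity), Real.log_pow, Real.log_pow, Real.log_pow]
    have h2 : Real.log d ≤ Real.log n := Real.log_le_log (by linarith) hnd
    have h3 : Real.log (1 + c₁) ≤ L := Real.log_le_log (by linarith) (by linarith)
    have h4 : Real.log (1 + c₂) ≤ L := Real.log_le_log (by linarith) (by linarith)
    push_cast
    linarith
  set l : ℕ := ⌈Real.logb 2 Q⌉₊ with hl
  have hQl : Q ≤ 2 ^ l := by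
    have h1 := Nat.le_ceil (Real.logb 2 Q)
    rw [Real.logb_le_iff_le_rpow (by norm_num) hQpos, Real.rpow_natCast] at h1
    exact h1
  obtain ⟨T, hT, hTm, hTi⟩ := exists_integrable_trees (Measure.pi fun _ : Fin n => D) b
    ((Nat.log 2 n + 1) * (64 * (12 * l * d + 15 * d + 21) *
      (Nat.clog 2 (64 * (12 * l * d + 15 * d + 21)) + 1)) + 64 * (12 * l * d + 15 * d + 21))
    {H | (∃ i, d * ((1 + c₁) * n ^ 2) < ‖f (H i)‖) ∨
      ¬ ThinSlabs (fun i => f (H i)) (1 / 2 ^ (2 * l)) (5 * d + 6)} (fun H hH => by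
        rw [Set.mem_ofPred_eq] at hH
        push Not at hH
        exact exists_tree_of_thinSlabs hd hn1 (by positivity) f b H hH.1 hH.2 (hQR.trans hQl)
          (by exact_mod_cast hQd.trans hQl) (by exact_mod_cast hQn.trans hQl)
          (Nat.le_pow_clog (by norm_num) _) (Nat.lt_pow_succ_log_self (by norm_num) n))
  refine ⟨T, hT, hTm, hTi.trans ?_⟩
  have hbad := measure_bad_le (n := n) D f hd hn1 hc₁ hc₂
    (fun α hα => by
      have := hconc α hα
      rwa [hf, Measure.map_apply hfm (measurableSet_lt measurable_const measurable_norm)] at this)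
    (fun α hα v hv t => by
      have := hanti α hα v hv t
      rwa [hf, Measure.map_apply hfm (measurableSet_le (by fun_prop) measurable_const)] at this)
    hQl
  -- Depth `n` on an event of probability at most `2 / n` contributes the summand `2`.
  refine (add_le_add le_rfl (mul_le_mul_right hbad (n : ℝ≥0∞))).trans ?_
  rw [← ENNReal.ofReal_natCast n, ← ENNReal.ofReal_mul (by positivity),
    mul_div_cancel₀ _ (by positivity), ← ENNReal.ofReal_natCast,
    ← ENNReal.ofReal_add (by positivity) (by norm_num)]
  exact ENNReal.ofReal_le_ofReal
    (depth_numerics hd hL hn (by linarith) hQL hl rfl)
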